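/- Let $n\ge 0$. **(1)** An *increasing ordered tree* on $n+1$ nodes is a rooted tree with nodes labeled $0,1,\dots,n$ and root $0$, whose labels increase along every path from the root to a leaf, together with a total order on the set of children of each node. For $q\ge 0$, a *$q$-blooming tree* on $n+1$ nodes is an increasing ordered tree on $n+1$ nodes with $q$ indistinguishable unlabeled extra nodes (blooms) appended to the root; only the positions of the blooms in the total order of the children of the root matter. For every integer $m\ge 2$, $$\sum_{\pi=\pi_1\mid\dots\mid\pi_k}\frac{(k+m-2)!}{(m-2)!}\,(2|\pi_1|-3)!!\cdots(2|\pi_k|-3)!!,$$ where the sum is over all partitions $\pi$ of $\{1,\dots,n\}$, $k$ is the number of blocks of $\pi$, and $(-1)!!=1$, equals the number of $(m-2)$-blooming trees on $n+1$ nodes. **(2)** Let $[[n]]=\{1,\bar 1,\dots,n,\bar n\}$ with the involution $i\leftrightarrow\bar i$, and let $\Sigma$ be a totally ordered set with $|\Sigma|=4$ (the elliptic case). A *$\Sigma$-labeled partition* of $[[n]]$ is a partition $x$ of $[[n]]$ such that $\bar R\in x$ for each block $R\in x$, together with an injective map to $\Sigma$ from the set of the blocks $R$ with $R=\bar R$.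 These are the *signed* blocks; the others are *unsigned*. Write $\Sigma(x)\subseteq\Sigma$ for the set of signs that occur in $x$, and $x_\sigma$ for the block with sign $\sigma$ ($x_\sigma=\emptyset$ if $\sigma\notin\Sigma(x)$). Put $x\preceq y$ if $x_\sigma\subseteq y_\sigma$ for all $\sigma\in\Sigma(x)$ and every unsigned block of $x$ is contained in a block of $y$. Adding a top element $\hat 1$ yields the poset $\Pi_{n,\Sigma}$ (the elliptic poset of type $C_n$), whose least element $\hat 0$ is the partition into unsigned singletons. The *representative* $r(R)$ of a block $R$ is the least $i\in\{1,\dots,n\}$ with $i\in R$ or $\bar i\in R$, and $R$ is *normalized* if $r(R)\in R$. Label the edges $x\prec\!\cdot\, y$ of the Hasse diagram of $\Pi_{n,\Sigma}$ by pairs of natural numbers, ordered lexicographically, as follows. * If $y=\hat 1$, the label is $(1,2)$. * If $x_\sigma\subsetneq y_\sigma$ for some $\sigma\in\Sigma$, the label is $(1,|\{\tau\in\Sigma(x):\tau\le\sigma\}|)$ if $\sigma\in\Sigma(x)$, and $(1,|\{\tau\in\Sigma:\tau\le\sigma\}\cup\Sigma(x)|)$ otherwise. * If $R\cup R'\in y$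 for distinct normalized unsigned blocks $R,R'$ of $x$, the label is $(0,\max(r(R),r(R')))$. * If $R\cup\overline{R'}\in y$ for distinct normalized unsigned blocks $R,R'$ of $x$, the label is $(2,\min(r(R),r(R')))$. Then the number of maximal chains of $\Pi_{n,\Sigma}$ from $\hat 0$ to $\hat 1$ whose sequence of edge labels, read from $\hat 0$ to $\hat 1$, is weakly decreasing is $(2n+1)!!$. -/

import Mathlib

open scoped Nat

/-! ## Partitions of `{1, 1̄, …, n, n̄}` labeled by a set of signs -/

/-- The set `[[n]] = {1, 1̄, …, n, n̄}`: the pair `(i, false)` is the element `i + 1` of `[n]`,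
and `(i, true)` is its barred copy. -/
abbrev BarredSet (n : ℕ) : Type := Fin n × Bool

namespace BarredSet

/-- The involution `X ↦ X̄` on subsets of `[[n]]`. -/
def bar {n : ℕ} (X : Finset (BarredSet n)) : Finset (BarredSet n) :=
  X.image fun a => (a.1, !a.2)

/-- The representative `r(R)`: the minimum `i ∈ [n] = {1, …, n}` with `i ∈ R` or `ī ∈ R`. -/
noncomputable def rep {n : ℕ} (R : Finset (BarredSet n)) : ℕ :=
  sInf {i : ℕ | ∃ a ∈ R, i = (a.1 : ℕ) + 1}

/-- A block is normalized if its representative (not its barred copy) belongs to it. -/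
def Normalized {n : ℕ} (R : Finset (BarredSet n)) : Prop :=
  ∃ i : Fin n, (i : ℕ) + 1 = rep R ∧ (i, false) ∈ R

theorem mem_bar {n : ℕ} {X : Finset (BarredSet n)} {a : BarredSet n} :
    a ∈ bar X ↔ (a.1, !a.2) ∈ X := by
  constructor
  · intro h
    obtain ⟨b, hb, rfl⟩ := Finset.mem_image.1 h
    simpa using hb
  · intro h
    exact Finset.mem_image.2 ⟨_, h, by simp⟩

theorem bar_mono {n : ℕ} {X Y : Finset (BarredSet n)} (h : X ⊆ Y) : bar X ⊆ bar Y :=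
  Finset.image_subset_image h

end BarredSet

open BarredSet

/-- A `S`-labeled partition of `[[n]]`: a partition of `[[n]]` whose set of blocks is closed under
`R ↦ R̄`, together with an injective labeling by signs of exactly those blocks with `R = R̄`.
`sign R = some σ` says that `R` is a signed block with sign `σ`; `sign R = none` says that `R` is
an unsigned block, or not a block at all. -/
@[ext]
structure LabeledPartition (n : ℕ) (S : Type*) where
  partition : Finpartition (Finset.univ : Finset (BarredSet n))
  sign : Finset (BarredSet n) → Option S
  bar_mem : ∀ R ∈ partition.parts, bar R ∈ partition.parts
  isSome_sign_iff : ∀ R, (sign R).isSome ↔ R ∈ partition.parts ∧ bar R = R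
  sign_injective : ∀ R R' σ, sign R = some σ → sign R' = some σ → R = R'

namespace LabeledPartition

variable {n : ℕ} {S : Type*}

/-- The set `Σ(π)` of the signs that occur in `π`. -/
def signs (π : LabeledPartition n S) : Set S :=
  {σ | ∃ R, π.sign R = some σ}

/-- The signed block `π_σ` with sign `σ` (empty if `σ ∉ Σ(π)`). -/
def signedBlock (π : LabeledPartition n S) (σ : S) : Set (BarredSet n) :=
  {a | ∃ R, π.sign R = some σ ∧ a ∈ R}

/-- `R` is an unsigned block of `π`. -/
def IsUnsignedBlock (π : LabeledPartition n S) (R : Finset (BarredSet n)) : Prop :=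
  R ∈ π.partition.parts ∧ π.sign R = none

/-- `π` is a refinement of `ψ`: each signed block of `π` is contained in the signed block of `ψ`
with the same sign, and each pair `R`, `R̄` of unsigned blocks of `π` is contained blockwise in a
pair `T`, `T̄` of (possibly equal) blocks of `ψ`. -/
def Refines (π ψ : LabeledPartition n S) : Prop :=
  (∀ σ ∈ π.signs, σ ∈ ψ.signs ∧ π.signedBlock σ ⊆ ψ.signedBlock σ) ∧
  ∀ R, π.IsUnsignedBlock R →
    ∃ T ∈ ψ.partition.parts, bar T ∈ ψ.partition.parts ∧ R ⊆ T ∧ bar R ⊆ bar T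

theorem mem_parts_of_sign {π : LabeledPartition n S} {R : Finset (BarredSet n)} {σ : S}
    (h : π.sign R = some σ) : R ∈ π.partition.parts :=
  ((π.isSome_sign_iff R).1 (by simp [h])).1

theorem signedBlock_eq {π : LabeledPartition n S} {R : Finset (BarredSet n)} {σ : S}
    (h : π.sign R = some σ) : π.signedBlock σ = (R : Set (BarredSet n)) := by
  ext a
  constructor
  · rintro ⟨R', h', ha⟩
    rwa [π.sign_injective R R' σ h h']
  · intro ha
    exact ⟨R, h, ha⟩

theorem Refines.exists_sign {π ψ : LabeledPartition n S} (h : π.Refines ψ)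
    {R : Finset (BarredSet n)} {σ : S} (hR : π.sign R = some σ) :
    ∃ R', ψ.sign R' = some σ ∧ R ⊆ R' := by
  obtain ⟨⟨R', hR'⟩, hsub⟩ := h.1 σ ⟨R, hR⟩
  rw [signedBlock_eq hR, signedBlock_eq hR', Finset.coe_subset] at hsub
  exact ⟨R', hR', hsub⟩

theorem Refines.exists_block {π ψ : LabeledPartition n S} (h : π.Refines ψ)
    {R : Finset (BarredSet n)} (hR : R ∈ π.partition.parts) :
    ∃ T ∈ ψ.partition.parts, R ⊆ T := by
  cases hs : π.sign R with
  | none =>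
    obtain ⟨T, hT, -, hRT, -⟩ := h.2 R ⟨hR, hs⟩
    exact ⟨T, hT, hRT⟩
  | some σ =>
    obtain ⟨R', hR', hsub⟩ := h.exists_sign hs
    exact ⟨R', mem_parts_of_sign hR', hsub⟩

theorem Refines.sign_eq {π ψ : LabeledPartition n S} (h : π.Refines ψ)
    (hp : π.partition = ψ.partition) {R : Finset (BarredSet n)} {σ : S}
    (hR : π.sign R = some σ) : ψ.sign R = some σ := by
  obtain ⟨R', hR', hsub⟩ := h.exists_sign hR
  have h1 : R ∈ ψ.partition.parts := hp ▸ mem_parts_of_sign hR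
  have h2 : R' ∈ ψ.partition.parts := mem_parts_of_sign hR'
  obtain ⟨a, ha⟩ := ψ.partition.nonempty_of_mem_parts h1
  rwa [ψ.partition.eq_of_mem_parts h1 h2 ha (hsub ha)]

/-- Labeled partitions are ordered by refinement. -/
instance : PartialOrder (LabeledPartition n S) where
  le := Refines
  le_refl π :=
    ⟨fun _ hσ => ⟨hσ, subset_rfl⟩,
      fun R hR => ⟨R, hR.1, π.bar_mem R hR.1, subset_rfl, subset_rfl⟩⟩
  le_trans π ψ χ h1 h2 := by
    refine ⟨fun σ hσ => ?_, fun R hR => ?_⟩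
    · exact ⟨(h2.1 σ (h1.1 σ hσ).1).1, (h1.1 σ hσ).2.trans (h2.1 σ (h1.1 σ hσ).1).2⟩
    · obtain ⟨T, hT, -, hRT, -⟩ := h1.2 R hR
      obtain ⟨U, hU, hTU⟩ := h2.exists_block hT
      exact ⟨U, hU, χ.bar_mem U hU, hRT.trans hTU, bar_mono (hRT.trans hTU)⟩
  le_antisymm π ψ h1 h2 := by
    have hp : π.partition = ψ.partition :=
      le_antisymm (fun _ hR => h1.exists_block hR) (fun _ hR => h2.exists_block hR)
    refine LabeledPartition.ext hp (funext fun R => ?_)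
    cases hs : π.sign R with
    | some σ => exact (h1.sign_eq hp hs).symm
    | none =>
      cases hs' : ψ.sign R with
      | none => rfl
      | some τ => rw [h2.sign_eq hp.symm hs'] at hs; exact absurd hs (by simp)

/-- The least element `0̂`: all blocks are unsigned singletons. -/
instance : OrderBot (LabeledPartition n S) where
  bot :=
    { partition := ⊥
      sign := fun _ => none
      bar_mem := by
        intro R hR
        obtain ⟨a, -, rfl⟩ := Finpartition.mem_bot_iff.1 hR
        exact Finpartition.mem_bot_iff.2 ⟨(a.1, !a.2), by simp, by simp [bar]⟩
      isSome_sign_iff := by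
        intro R
        refine ⟨fun h => absurd h (by simp), ?_⟩
        rintro ⟨hR, hbar⟩
        obtain ⟨a, -, rfl⟩ := Finpartition.mem_bot_iff.1 hR
        have h := congrArg Prod.snd (Finset.singleton_injective (hbar.symm.trans
          (show bar {a} = {(a.1, !a.2)} by simp [bar])))
        exact absurd h (by simp)
      sign_injective := fun _ _ _ h => absurd h (by simp) }
  bot_le ψ := by
    change LabeledPartition.Refines _ ψ
    refine ⟨fun σ hσ => ?_, fun R hR => ?_⟩
    · obtain ⟨R, hR⟩ := hσ
      exact absurd hR (by simp)
    · obtain ⟨a, -, rfl⟩ := Finpartition.mem_bot_iff.1 hR.1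
      obtain ⟨T, hT, ha⟩ := ψ.partition.exists_mem (Finset.mem_univ a)
      have hs : ({a} : Finset (BarredSet n)) ⊆ T := Finset.singleton_subset_iff.2 ha
      exact ⟨T, hT, ψ.bar_mem T hT, hs, bar_mono hs⟩

end LabeledPartition

/-- The poset `Π_{n,S}` of labeled partitions of `[[n]]` with a new top element `1̂ = ⊤`; its
least element is `0̂ = ⊥`. It is the poset of type `C_n`, elliptic when `S` has four elements. -/
abbrev LabeledPartitionPoset (n : ℕ) (S : Type*) : Type _ := WithTop (LabeledPartition n S)

/-! ## The edge labeling -/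

namespace LabeledPartition

variable {n : ℕ} {S : Type*}

/-- The edge from `x` to `y` is of sign `σ`. -/
def IsOfSign (x y : LabeledPartition n S) (σ : S) : Prop :=
  x.signedBlock σ ⊂ y.signedBlock σ

/-- The edge from `x` to `y` merges the distinct normalized unsigned blocks `R` and `R'` of `x`
to the block `R ∪ R'` of `y`. -/
def CoherentMerge (x y : LabeledPartition n S) (R R' : Finset (BarredSet n)) : Prop :=
  x.IsUnsignedBlock R ∧ x.IsUnsignedBlock R' ∧ Normalized R ∧ Normalized R' ∧ R ≠ R' ∧
    R ∪ R' ∈ y.partition.parts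

/-- The edge from `x` to `y` merges the blocks `R` and `R̄'` of `x`, for distinct normalized
unsigned blocks `R` and `R'` of `x`, to the block `R ∪ R̄'` of `y`. -/
def NonCoherentMerge (x y : LabeledPartition n S) (R R' : Finset (BarredSet n)) : Prop :=
  x.IsUnsignedBlock R ∧ x.IsUnsignedBlock R' ∧ Normalized R ∧ Normalized R' ∧ R ≠ R' ∧
    R ∪ bar R' ∈ y.partition.parts

open Classical in
/-- The label of an edge of sign `σ` starting at `x`. -/
noncomputable def signedLabel [LinearOrder S] (x : LabeledPartition n S) (σ : S) : ℕ ×ₗ ℕ :=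
  if σ ∈ x.signs then toLex (1, {τ | τ ∈ x.signs ∧ τ ≤ σ}.ncard)
  else toLex (1, ({τ | τ ≤ σ} ∪ x.signs).ncard)

open Classical in
/-- The label of the edge from `x` to `y`, where `y` covers `x`: an edge is of exactly one of the
three types, with a unique sign, or a pair of merged blocks that is unique up to order. (The value
is only meaningful, and only used, for edges.) -/
noncomputable def label [LinearOrder S] (x y : LabeledPartition n S) : ℕ ×ₗ ℕ :=
  if h : ∃ σ, IsOfSign x y σ then signedLabel x h.choose
  else if h : ∃ p : Finset (BarredSet n) × Finset (BarredSet n), CoherentMerge x y p.1 p.2 then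
    toLex (0, max (rep h.choose.1) (rep h.choose.2))
  else if h : ∃ p : Finset (BarredSet n) × Finset (BarredSet n), NonCoherentMerge x y p.1 p.2 then
    toLex (2, min (rep h.choose.1) (rep h.choose.2))
  else toLex (0, 0)

end LabeledPartition

/-- The edge labeling `λ` of `Π_{n,S}`, with labels ordered lexicographically; edges to `1̂` have
the label `(1, 2)`. -/
noncomputable def edgeLabel {n : ℕ} {S : Type*} [LinearOrder S] :
    LabeledPartitionPoset n S → LabeledPartitionPoset n S → ℕ ×ₗ ℕ
  | WithTop.some x, WithTop.some y => LabeledPartition.label x y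
  | _, _ => toLex (1, 2)

/-! ## Maximal chains and their words -/

/-- `c` is a maximal chain `x ⋖ z₁ ⋖ ⋯ ⋖ z_t ⋖ y` from `x` to `y`, listed upwards. -/
def IsMaximalChainBetween {P : Type*} [Preorder P] (x y : P) (c : List P) : Prop :=
  c.head? = some x ∧ c.getLast? = some y ∧ c.IsChain (· ⋖ ·)

/-- The word `lam x z₁, lam z₁ z₂, …, lam z_t y` of a chain. -/
def chainWord {P L : Type*} (lam : P → P → L) (c : List P) : List L :=
  List.zipWith lam c c.tail

/-- A chain is decreasing if its word is weakly decreasing. -/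
def IsDecreasingChain {P L : Type*} [LE L] (lam : P → P → L) (c : List P) : Prop :=
  (chainWord lam c).Pairwise (· ≥ ·)

/-! ## Increasing ordered trees and blooming trees -/

/-- An increasing ordered tree on the `n + 1` nodes `0, …, n`, with root `0`: every node has a
list of children, without repetition (that is, a totally ordered set of children), every node
other than the root is a child of exactly one node, and labels increase from a node to its
children. (So the root is nobody's child, and every node is reached from the root by the path
through its iterated parents, whose labels decrease.) -/
@[ext]
structure IncreasingOrderedTree (n : ℕ) where
  children : Fin (n + 1) → List (Fin (n + 1))
  nodup : ∀ v, (children v).Nodup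
  exists_unique_parent : ∀ w, w ≠ 0 → ∃! v, w ∈ children v
  lt_of_mem : ∀ v w, w ∈ children v → v < w

/-- A `q`-blooming tree on `n + 1` nodes: an increasing ordered tree together with a total order
on its root's children and `q` indistinguishable additional children of the root (the blooms),
extending the given order of the root's children. In the list `rootChildren`, the entry `none` is
a bloom and `some w` is the child `w` of the root. -/
@[ext]
structure BloomingTree (q n : ℕ) where
  tree : IncreasingOrderedTree n
  rootChildren : List (Option (Fin (n + 1)))
  reduceOption_eq : rootChildren.reduceOption = tree.children 0
  count_bloom : rootChildren.count none = q

/-! ## The formula -/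

/-- The sum, over all partitions `π = π₁ | ⋯ | π_k` of `[n]`, of
`f(π) (2|π₁| - 3)!! ⋯ (2|π_k| - 3)!!`. A block of size 1 contributes the factor `(-1)!! = 1`, which
is here the value `0‼ = 1` of the truncated subtraction. -/
def partitionSum (n : ℕ) (f : Finpartition (Finset.univ : Finset (Fin n)) → ℕ) : ℕ :=
  ∑ π, f π * ∏ B ∈ π.parts, (2 * B.card - 3)‼

/-- `f(π) = (k + m - 2)! / (m - 2)!`, where `k` is the number of blocks of `π`, for `m ≥ 2`
(an exact division). -/
def typeCWeight (m : ℕ) {n : ℕ} (π : Finpartition (Finset.univ : Finset (Fin n))) : ℕ :=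
  (π.parts.card + m - 2)! / (m - 2)!

/-! For (1), put $q=m-2$; both sides equal $\prod_{i<n}(2i+1+q)$. A tree on nodes $0,\dots,n$ with
$q$ blooms has $n+q$ entries in its child lists. Each of the $n+1$ nodes offers one slot more than
the length of its list, so node $n+1$ can be attached in $2n+1+q$ ways
(`BloomingTree.IsGrown.card_succ`). For the sum, adding an element to a partition with $k$ blocks
multiplies the weight by $q+1+k$ if the element is a new block, and by $2|B|-1$ if it joins the
block $B$. On a set with $n$ elements these factors add up to the same $2n+1+q$.

For (2), a labeled partition is studied through the representatives of its unsigned blocks. The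
covers of $x$ below $\hat 1$ are the merges of the block of a representative $q$ into a target $t$:
a sign, or the block of $\pm p$ for a smaller representative $p$. The pair $(q,t)$ is unique and
only $q$ stops being a representative (`covBy_iff`, `reps_merge`, `merge_injective`).

The last label of every chain is $(1,2)$, so a decreasing chain has no label $(0,\cdot)$. It
consists of noncoherent merges, then signed edges, then the edge to $\hat 1$. At every $x$ the four
signs carry the labels $(1,1),\dots,(1,4)$ once each, so the number $c_k(j)$ of continuations with
labels at most $(1,j)$ depends only on the number $k$ of representatives: $c_k(j)=k\sum_{i\le
j}c_{k-1}(i)$, which gives $0,\ k!,\ (k+1)!,\ (k+2)!/2$ for $j=1,2,3,4$. With labels at most $(2,a)$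
and $i$ representatives at most $a$, the edges labeled by the $r$-th representative $p$ correspond
to the larger representatives $q$, and removing $q$ keeps the rank of $p$. Hence
$N(k+1,i)=c_{k+1}(4)+\sum_{r=1}^{i}(k+1-r)N(k,r)$, with solution $N(k,i)=(k+i+2)!/(2^{i+1}(i+1)!)$.
At $\hat 0$ this is $N(n,n)=(2n+1)!!$. -/

/-! ## Counting blooming trees -/

namespace BloomingTree

/-- Child lists, with `none` for the blooms, on nodes taken from `0, …, N`, in which exactly the
nodes `1, …, n` have been attached. -/
structure IsGrown {N : ℕ} (q n : ℕ) (L : Fin (N + 1) → List (Option (Fin (N + 1)))) : Prop where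
  lt_of_mem : ∀ v w, some w ∈ L v → v < w
  le_of_mem : ∀ v w, some w ∈ L v → (w : ℕ) ≤ n
  exists_unique_parent : ∀ w : Fin (N + 1), w ≠ 0 → (w : ℕ) ≤ n → ∃! v, some w ∈ L v
  count_le : ∀ v w, (L v).count (some w) ≤ 1
  count_bloom : (L 0).count none = q
  not_bloom : ∀ v, v ≠ 0 → none ∉ L v

/-- The child lists of a blooming tree. -/
def lists {q n : ℕ} (t : BloomingTree q n) (v : Fin (n + 1)) : List (Option (Fin (n + 1))) :=
  if v = 0 then t.rootChildren else (t.tree.children v).map some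

theorem mem_rootChildren {q n : ℕ} (t : BloomingTree q n) (w : Fin (n + 1)) :
    some w ∈ t.rootChildren ↔ w ∈ t.tree.children 0 := by
  rw [← t.reduceOption_eq, List.reduceOption_mem_iff]

theorem mem_lists {q n : ℕ} (t : BloomingTree q n) (v w : Fin (n + 1)) :
    some w ∈ t.lists v ↔ w ∈ t.tree.children v := by
  unfold lists
  split_ifs with h
  · rw [h, mem_rootChildren]
  · simp

theorem count_reduceOption {α : Type*} [DecidableEq α] (l : List (Option α)) (a : α) :
    l.reduceOption.count a = l.count (some a) := by
  induction l with
  | nil => simp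
  | cons o l ih =>
    cases o with
    | none => simp [List.reduceOption_cons_of_none, ih]
    | some b => simp [List.reduceOption_cons_of_some, List.count_cons, ih]

theorem map_some_reduceOption {α : Type*} (l : List (Option α)) (h : none ∉ l) :
    l.reduceOption.map some = l := by
  induction l with
  | nil => rfl
  | cons a l ih =>
    cases a with
    | none => simp at h
    | some a =>
      simp only [List.mem_cons, not_or] at h
      simp [List.reduceOption_cons_of_some, ih h.2]

theorem isGrown_lists {q n : ℕ} (t : BloomingTree q n) : IsGrown q n t.lists where
  lt_of_mem v w h := t.tree.lt_of_mem v w ((t.mem_lists v w).1 h)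
  le_of_mem v w _ := by omega
  exists_unique_parent w hw _ := by
    simpa only [mem_lists] using t.tree.exists_unique_parent w hw
  count_le v w := by
    unfold lists
    split_ifs with h
    · rw [← count_reduceOption, t.reduceOption_eq]
      exact List.nodup_iff_count_le_one.1 (t.tree.nodup 0) w
    · rw [List.count_map_of_injective _ _ (Option.some_injective _)]
      exact List.nodup_iff_count_le_one.1 (t.tree.nodup v) w
  count_bloom := by simp [lists, t.count_bloom]
  not_bloom v hv := by simp [lists, hv]

theorem lists_injective {q n : ℕ} :
    Function.Injective (lists : BloomingTree q n → _) := by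
  intro t u h
  have h0 : t.rootChildren = u.rootChildren := by simpa [lists] using congrFun h 0
  refine BloomingTree.ext (IncreasingOrderedTree.ext (funext fun v => ?_)) h0
  by_cases hv : v = 0
  · rw [hv, ← t.reduceOption_eq, ← u.reduceOption_eq, h0]
  · have := congrFun h v
    simp only [lists, hv, if_false] at this
    exact (List.map_injective_iff.2 (Option.some_injective _)) this

theorem exists_lists_eq {q n : ℕ} (L : Fin (n + 1) → List (Option (Fin (n + 1))))
    (hL : IsGrown q n L) : ∃ t : BloomingTree q n, t.lists = L := by
  refine ⟨⟨⟨fun v => (L v).reduceOption, fun v => ?_, fun w hw => ?_, fun v w h => ?_⟩, L 0, rfl,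
    hL.count_bloom⟩, funext fun v => ?_⟩
  · exact List.nodup_iff_count_le_one.2 fun w => by
      rw [count_reduceOption]; exact hL.count_le v w
  · simpa only [List.reduceOption_mem_iff] using
      hL.exists_unique_parent w hw (by omega)
  · exact hL.lt_of_mem v w (List.reduceOption_mem_iff.1 h)
  · unfold lists
    split_ifs with h
    · rw [h]
    · exact map_some_reduceOption _ (hL.not_bloom v h)

/-- The root order with blooms already contains the order of the root's children, so one family of
lists carries all the data. `IsGrown` keeps the ambient bound `N` separate from `n`, so that nodes
can be attached one at a time within a fixed type. -/
theorem card_eq_card_isGrown (q n : ℕ) :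
    Nat.card (BloomingTree q n) =
      Nat.card {L : Fin (n + 1) → List (Option (Fin (n + 1))) // IsGrown q n L} :=
  Nat.card_eq_of_bijective (fun t => ⟨t.lists, t.isGrown_lists⟩)
    ⟨fun _ _ h => lists_injective (congrArg Subtype.val h),
      fun L => (exists_lists_eq L.1 L.2).imp fun _ h => Subtype.ext h⟩

/-! ### Counting the slots for a new node -/

namespace IsGrown

variable {N q n : ℕ} {L : Fin (N + 1) → List (Option (Fin (N + 1)))}

theorem sum_count (hL : IsGrown q n L) (w : Fin (N + 1)) :
    ∑ v, (L v).count (some w) = if w ≠ 0 ∧ (w : ℕ) ≤ n then 1 else 0 := by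
  split_ifs with h
  · obtain ⟨v, hv, huniq⟩ := hL.exists_unique_parent w h.1 h.2
    rw [Finset.sum_eq_single v]
    · exact le_antisymm (hL.count_le v w) (List.count_pos_iff.2 hv)
    · intro u _ hu
      exact List.count_eq_zero.2 fun hm => hu (huniq u hm)
    · simp
  · refine Finset.sum_eq_zero fun v _ => List.count_eq_zero.2 fun hm => h ⟨?_, hL.le_of_mem v w hm⟩
    rintro rfl
    exact absurd (hL.lt_of_mem v 0 hm) (by simp)

theorem sum_count_none (hL : IsGrown q n L) : ∑ v, (L v).count none = q := by
  rw [Finset.sum_eq_single 0, hL.count_bloom]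
  · exact fun v _ hv => List.count_eq_zero.2 (hL.not_bloom v hv)
  · simp

theorem length_eq_sum_count {α : Type*} [Fintype α] [BEq α] [LawfulBEq α] (l : List α) :
    l.length = ∑ a, l.count a := by
  classical
  induction l with
  | nil => simp
  | cons b l ih => simp [List.count_cons, Finset.sum_add_distrib, ih]

/-- Double counting: each of the nodes `1, …, n` is an entry of exactly one list, once, and the
remaining entries are the `q` blooms. -/
theorem sum_length (hL : IsGrown q n L) (hn : n ≤ N) : ∑ v, (L v).length = n + q := by
  simp_rw [length_eq_sum_count]
  rw [Finset.sum_comm, Fintype.sum_option, hL.sum_count_none, add_comm]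
  congr 1
  simp_rw [hL.sum_count]
  rw [Finset.sum_boole, Nat.cast_id]
  have : (Finset.univ.filter fun w : Fin (N + 1) => w ≠ 0 ∧ (w : ℕ) ≤ n) =
      Finset.Ioc 0 (⟨n, by omega⟩ : Fin (N + 1)) := by
    ext w
    simp only [Finset.mem_filter, Finset.mem_univ, true_and, Finset.mem_Ioc, Fin.pos_iff_ne_zero,
      Fin.le_def]
  rw [this, Fin.card_Ioc]
  simp

theorem eq_nil (hL : IsGrown q n L) {v : Fin (N + 1)} (hv : n < (v : ℕ)) : L v = [] := by
  rw [List.eq_nil_iff_forall_not_mem]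
  rintro (_ | w) hw
  · exact hL.not_bloom v (by rintro rfl; simp at hv) hw
  · have h1 := hL.lt_of_mem v w hw
    have h2 := hL.le_of_mem v w hw
    omega

/-- The places where a new node can be attached. -/
abbrev Slot (n : ℕ) (L : Fin (N + 1) → List (Option (Fin (N + 1)))) : Type :=
  Σ v : {v : Fin (N + 1) // (v : ℕ) ≤ n}, Fin ((L v).length + 1)

theorem card_slot (hL : IsGrown q n L) (hn : n ≤ N) : Nat.card (Slot n L) = 2 * n + 1 + q := by
  have h1 : ∑ v : {v : Fin (N + 1) // (v : ℕ) ≤ n}, (L v).length = ∑ v, (L v).length := by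
    rw [← Fintype.sum_subtype_add_sum_subtype (fun v : Fin (N + 1) => (v : ℕ) ≤ n)]
    simp only [left_eq_add]
    exact Finset.sum_eq_zero fun v _ => by rw [hL.eq_nil (not_le.1 v.2), List.length_nil]
  have h2 : Fintype.card {v : Fin (N + 1) // (v : ℕ) ≤ n} = n + 1 := by
    rw [Fintype.card_subtype]
    have : (Finset.univ.filter fun v : Fin (N + 1) => (v : ℕ) ≤ n) =
        Finset.Iic (⟨n, by omega⟩ : Fin (N + 1)) := by
      ext v
      simp [Fin.le_def]
    rw [this, Fin.card_Iic]
  simp only [Nat.card_eq_fintype_card, Fintype.card_sigma, Fintype.card_fin,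
    Finset.sum_add_distrib, h1, hL.sum_length hn, Finset.sum_const, Finset.card_univ, h2]
  simp
  omega

end IsGrown

/-! ### Inserting into and erasing from a list -/

section List

variable {α : Type*} [BEq α] [LawfulBEq α]

theorem erase_insertIdx {a : α} {l : List α} {i : ℕ} (hi : i ≤ l.length) (ha : a ∉ l) :
    (l.insertIdx i a).erase a = l := by
  induction i generalizing l with
  | zero => simp
  | succ i ih =>
    cases l with
    | nil => simp at hi
    | cons b l =>
      simp only [List.mem_cons, not_or] at ha
      simp [List.insertIdx_succ_cons, Ne.symm ha.1,
        ih (by simpa using hi) ha.2]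

theorem idxOf_insertIdx {a : α} {l : List α} {i : ℕ} (hi : i ≤ l.length) (ha : a ∉ l) :
    (l.insertIdx i a).idxOf a = i := by
  induction i generalizing l with
  | zero => simp
  | succ i ih =>
    cases l with
    | nil => simp at hi
    | cons b l =>
      simp only [List.mem_cons, not_or] at ha
      simp [List.insertIdx_succ_cons, Ne.symm ha.1,
        ih (by simpa using hi) ha.2]

theorem exists_insertIdx_erase {a : α} {l : List α} (ha : a ∈ l) :
    ∃ i ≤ (l.erase a).length, (l.erase a).insertIdx i a = l := by
  obtain ⟨s, t, hs, rfl, h⟩ := List.exists_erase_eq ha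
  rw [h]
  refine ⟨s.length, by simp, ?_⟩
  clear h ha hs
  induction s with
  | nil => simp
  | cons b s ih => simpa using ih

theorem count_insertIdx [DecidableEq α] {a b : α} {l : List α} {i : ℕ} (hi : i ≤ l.length) :
    (l.insertIdx i a).count b = l.count b + if a = b then 1 else 0 := by
  rw [(List.perm_insertIdx a l hi).count_eq, List.count_cons]
  simp

end List

/-! ### Attaching and removing the largest node -/

namespace IsGrown

variable {N q n : ℕ} {L : Fin (N + 1) → List (Option (Fin (N + 1)))}

/-- The list `L` with the node `a` attached in a given slot. -/
def grow (a : Fin (N + 1)) (L : Fin (N + 1) → List (Option (Fin (N + 1)))) (p : Slot n L) :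
    Fin (N + 1) → List (Option (Fin (N + 1))) :=
  Function.update L p.1 ((L p.1).insertIdx p.2 (some a))

theorem some_notMem (hL : IsGrown q n L) {a : Fin (N + 1)} (ha : (a : ℕ) = n + 1)
    (v : Fin (N + 1)) : some a ∉ L v := fun h => by
  have := hL.le_of_mem v a h
  omega

theorem mem_grow {a : Fin (N + 1)} {p : Slot n L} {v : Fin (N + 1)}
    {o : Option (Fin (N + 1))} : o ∈ grow a L p v ↔ o ∈ L v ∨ (v = p.1 ∧ o = some a) := by
  unfold grow
  by_cases h : v = p.1
  · subst h
    rw [Function.update_self, List.mem_insertIdx (Nat.le_of_lt_succ p.2.2)]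
    tauto
  · rw [Function.update_of_ne h]
    tauto

theorem count_grow {a : Fin (N + 1)} {p : Slot n L} {v : Fin (N + 1)}
    {o : Option (Fin (N + 1))} :
    (grow a L p v).count o = (L v).count o + if v = p.1 ∧ some a = o then 1 else 0 := by
  unfold grow
  by_cases h : v = p.1
  · subst h
    rw [Function.update_self, count_insertIdx (Nat.le_of_lt_succ p.2.2)]
    simp
  · rw [Function.update_of_ne h]
    simp [h]

theorem isGrown_grow (hL : IsGrown q n L) {a : Fin (N + 1)} (ha : (a : ℕ) = n + 1)
    (p : Slot n L) : IsGrown q (n + 1) (grow a L p) where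
  lt_of_mem v w h := by
    rcases mem_grow.1 h with h | ⟨rfl, hw⟩
    · exact hL.lt_of_mem v w h
    · obtain rfl := Option.some_injective _ hw
      have := p.1.2
      rw [Fin.lt_def]
      omega
  le_of_mem v w h := by
    rcases mem_grow.1 h with h | ⟨rfl, hw⟩
    · exact (hL.le_of_mem v w h).trans (Nat.le_succ n)
    · obtain rfl := Option.some_injective _ hw
      exact ha.le
  exists_unique_parent w hw hwn := by
    simp only [mem_grow]
    by_cases h : w = a
    · subst h
      exact ⟨p.1, Or.inr ⟨rfl, rfl⟩, fun v hv => hv.elim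
        (fun h => absurd h (hL.some_notMem ha v)) And.left⟩
    · simpa [h] using hL.exists_unique_parent w hw (by
        have : (w : ℕ) ≠ a := fun h' => h (Fin.ext h')
        omega)
  count_le v w := by
    rw [count_grow]
    split_ifs with h
    · obtain ⟨-, h⟩ := h
      rw [← h, List.count_eq_zero.2 (hL.some_notMem ha v)]
    · exact hL.count_le v w
  count_bloom := by simp [count_grow, hL.count_bloom]
  not_bloom v hv := by simpa [mem_grow] using hL.not_bloom v hv

theorem exists_grow_eq {M : Fin (N + 1) → List (Option (Fin (N + 1)))}
    (hM : IsGrown q (n + 1) M) {a : Fin (N + 1)} (ha : (a : ℕ) = n + 1) :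
    ∃ L, IsGrown q n L ∧ ∃ p : Slot n L, grow a L p = M := by
  obtain ⟨u, hu, huniq⟩ := hM.exists_unique_parent a (by
    rintro rfl
    simp at ha) ha.le
  -- The parent of the largest node has a smaller label, so it is one of the nodes that offer a
  -- slot.
  have hun : (u : ℕ) ≤ n := by
    have := hM.lt_of_mem u a hu
    rw [Fin.lt_def] at this
    omega
  set L : Fin (N + 1) → List (Option (Fin (N + 1))) := fun v => (M v).erase (some a) with hLdef
  have hcount : ∀ v o, o ≠ some a → (L v).count o = (M v).count o := fun v o ho =>
    List.count_erase_of_ne ho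
  have hmem : ∀ v o, o ≠ some a → (o ∈ L v ↔ o ∈ M v) := fun v o ho => List.mem_erase_of_ne ho
  have hnot : ∀ v, some a ∉ L v := fun v => by
    rw [← List.count_eq_zero, List.count_erase_self]
    have := hM.count_le v a
    omega
  obtain ⟨i, hi, hiM⟩ := exists_insertIdx_erase hu
  refine ⟨L, ⟨?_, ?_, ?_, ?_, ?_, ?_⟩, ⟨⟨u, hun⟩, ⟨i, Nat.lt_succ_of_le hi⟩⟩, ?_⟩
  · exact fun v w h => hM.lt_of_mem v w (List.mem_of_mem_erase h)
  · intro v w h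
    have h1 := hM.le_of_mem v w (List.mem_of_mem_erase h)
    have h2 : (w : ℕ) ≠ a := fun h' => hnot v (Fin.ext h' ▸ h)
    omega
  · intro w hw hwn
    have hwa : some w ≠ some a := by
      rintro ⟨⟩
      omega
    simpa only [hmem _ _ hwa] using hM.exists_unique_parent w hw (hwn.trans (Nat.le_succ n))
  · intro v w
    by_cases hwa : some w = some a
    · rw [hwa, List.count_eq_zero.2 (hnot v)]
      exact Nat.zero_le 1
    · rw [hcount v _ hwa]
      exact hM.count_le v w
  · rw [hcount 0 _ (by simp), hM.count_bloom]
  · intro v hv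
    rw [hmem v _ (by simp)]
    exact hM.not_bloom v hv
  · funext v
    unfold grow
    by_cases h : v = u
    · subst h
      simpa using hiM
    · rw [Function.update_of_ne (by exact h)]
      exact List.erase_of_not_mem fun h' => h (huniq v h')

/-- Erasing the new node recovers `L`; the list that contains it and its index there recover the
slot. The equality is one of dependent pairs because the type of slots depends on `L`. -/
theorem grow_injective {L' : Fin (N + 1) → List (Option (Fin (N + 1)))} (hL : IsGrown q n L)
    (hL' : IsGrown q n L') {a : Fin (N + 1)} (ha : (a : ℕ) = n + 1) {p : Slot n L}
    {p' : Slot n L'} (h : grow a L p = grow a L' p') :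
    (⟨L, p⟩ : Σ L, Slot n L) = ⟨L', p'⟩ := by
  have herase : ∀ {L} (_ : IsGrown q n L) (p : Slot n L) v,
      (grow a L p v).erase (some a) = L v := by
    intro L hL p v
    unfold grow
    by_cases h : v = p.1
    · subst h
      rw [Function.update_self,
        erase_insertIdx (Nat.le_of_lt_succ p.2.2) (hL.some_notMem ha _)]
    · rw [Function.update_of_ne h, List.erase_of_not_mem (hL.some_notMem ha _)]
  obtain rfl : L = L' := funext fun v => by rw [← herase hL p v, h, herase hL' p' v]
  have hp : p.1 = p'.1 := by
    have h1 : some a ∈ grow a L p' p.1 := h ▸ mem_grow.2 (Or.inr ⟨rfl, rfl⟩)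
    exact Subtype.ext ((mem_grow.1 h1).resolve_left (hL.some_notMem ha _)).1
  obtain ⟨v, i⟩ := p
  obtain ⟨v', i'⟩ := p'
  obtain rfl : v = v' := hp
  have hi := congrFun h v
  simp only [grow, Function.update_self] at hi
  have := congrArg (List.idxOf (some a)) hi
  rw [idxOf_insertIdx (Nat.le_of_lt_succ i.2) (hL.some_notMem ha _),
    idxOf_insertIdx (Nat.le_of_lt_succ i'.2) (hL.some_notMem ha _)] at this
  rw [Fin.ext this]

/-- Attaching is a bijection from pairs (lists, slot), and the number of slots does not depend on
the lists. Finiteness is carried along because summing over the lists requires it. -/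
theorem card_succ (hn : n + 1 ≤ N) [Finite {L : Fin (N + 1) → _ // IsGrown q n L}] :
    Finite {L : Fin (N + 1) → _ // IsGrown q (n + 1) L} ∧
    Nat.card {L : Fin (N + 1) → _ // IsGrown q (n + 1) L} =
      (2 * n + 1 + q) * Nat.card {L : Fin (N + 1) → _ // IsGrown q n L} := by
  set a : Fin (N + 1) := ⟨n + 1, by omega⟩ with ha
  let f : (Σ L : {L : Fin (N + 1) → _ // IsGrown q n L}, Slot n L.1) →
      {L : Fin (N + 1) → _ // IsGrown q (n + 1) L} :=
    fun x => ⟨grow a x.1.1 x.2, x.1.2.isGrown_grow rfl x.2⟩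
  have hf : Function.Bijective f := by
    refine ⟨fun x y h => ?_, fun M => ?_⟩
    · obtain ⟨⟨L, hL⟩, p⟩ := x
      obtain ⟨⟨L', hL'⟩, p'⟩ := y
      have := grow_injective hL hL' rfl (congrArg Subtype.val h)
      cases this
      rfl
    · obtain ⟨L, hL, p, h⟩ := M.2.exists_grow_eq (a := a) rfl
      exact ⟨⟨⟨L, hL⟩, p⟩, Subtype.ext h⟩
  have := Fintype.ofFinite {L : Fin (N + 1) → _ // IsGrown q n L}
  refine ⟨Finite.of_surjective f hf.2, ?_⟩
  rw [← Nat.card_eq_of_bijective f hf, Nat.card_sigma,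
    Finset.sum_congr rfl fun L _ => L.2.card_slot (by omega)]
  simp [mul_comm]

theorem isGrown_zero_iff :
    IsGrown q 0 L ↔ L = fun v => if v = 0 then List.replicate q none else [] := by
  constructor
  · intro hL
    have hw : ∀ v w, some w ∉ L v := fun v w h => by
      have h1 := hL.lt_of_mem v w h
      have h2 := hL.le_of_mem v w h
      omega
    funext v
    split_ifs with hv
    · subst hv
      have h1 : ∀ o ∈ L 0, o = none := by
        rintro (_ | w) ho
        · rfl
        · exact absurd ho (hw 0 w)
      rw [List.eq_replicate_of_mem h1, ← hL.count_bloom,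
        List.count_eq_length.2 fun o ho => (h1 o ho).symm]
    · rw [List.eq_nil_iff_forall_not_mem]
      rintro (_ | w) ho
      · exact hL.not_bloom v hv ho
      · exact hw v w ho
  · rintro rfl
    refine ⟨?_, ?_, ?_, ?_, ?_, ?_⟩
    · intro v w h
      split_ifs at h <;> simp [List.mem_replicate] at h
    · intro v w h
      split_ifs at h <;> simp [List.mem_replicate] at h
    · intro w hw hw0
      exact absurd (Fin.ext (by simpa using hw0)) hw
    · intro v w
      split_ifs <;> simp [List.count_replicate]
    · simp
    · intro v hv
      simp [hv]

theorem card_eq (hn : n ≤ N) : Finite {L : Fin (N + 1) → _ // IsGrown q n L} ∧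
    Nat.card {L : Fin (N + 1) → _ // IsGrown q n L} = ∏ i ∈ Finset.range n, (2 * i + 1 + q) := by
  induction n with
  | zero =>
    simp only [isGrown_zero_iff]
    exact ⟨inferInstance, by simp⟩
  | succ n ih =>
    obtain ⟨hfin, hcard⟩ := ih (by omega)
    have := card_succ (q := q) hn
    rw [hcard, mul_comm] at this
    rwa [Finset.prod_range_succ]

end IsGrown

theorem card_eq_prod (q n : ℕ) :
    Nat.card (BloomingTree q n) = ∏ i ∈ Finset.range n, (2 * i + 1 + q) := by
  rw [card_eq_card_isGrown, (IsGrown.card_eq le_rfl).2]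

end BloomingTree

/-! ## The sum over set partitions -/

namespace Finpartition

variable {α : Type*} [DecidableEq α]

/-- Add a new element `a` to the block `B` of a partition, or as a new block if `B = ∅`. -/
def insertInto {s : Finset α} {a : α} (ha : a ∉ s) (π : Finpartition s) (B : Finset α)
    (hB : B ∈ insert ∅ π.parts) : Finpartition (insert a s) :=
  Finpartition.ofExistsUnique (insert (insert a B) (π.parts.erase B))
    (by
      have hBs : B ⊆ s := by
        rcases Finset.mem_insert.1 hB with rfl | hB
        · simp
        · exact π.subset hB
      intro p hp
      rcases Finset.mem_insert.1 hp with rfl | hp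
      · exact Finset.insert_subset_insert a hBs
      · exact (π.subset (Finset.mem_of_mem_erase hp)).trans (Finset.subset_insert a s))
    (by
      intro b hb
      have hn : ∀ p ∈ π.parts.erase B, a ∉ p := fun p hp h =>
        ha (π.subset (Finset.mem_of_mem_erase hp) h)
      rcases Finset.mem_insert.1 hb with rfl | hbs
      · refine ⟨insert b B, ⟨by simp, by simp⟩, ?_⟩
        rintro t ⟨ht, hbt⟩
        rcases Finset.mem_insert.1 ht with rfl | ht
        · rfl
        · exact absurd hbt (hn t ht)
      · have hba : b ≠ a := fun h => ha (h ▸ hbs)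
        by_cases hbB : b ∈ B
        · have hBp : B ∈ π.parts := (Finset.mem_insert.1 hB).resolve_left
            (by rintro rfl; simp at hbB)
          refine ⟨insert a B, ⟨by simp, by simp [hbB]⟩, ?_⟩
          rintro t ⟨ht, hbt⟩
          rcases Finset.mem_insert.1 ht with rfl | ht
          · rfl
          · exact absurd (π.eq_of_mem_parts (Finset.mem_of_mem_erase ht) hBp hbt hbB)
              (Finset.ne_of_mem_erase ht)
        · obtain ⟨t, ht, hbt⟩ := π.exists_mem hbs
          refine ⟨t, ⟨Finset.mem_insert_of_mem (Finset.mem_erase.2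
            ⟨by rintro rfl; exact hbB hbt, ht⟩), hbt⟩, ?_⟩
          rintro u ⟨hu, hbu⟩
          rcases Finset.mem_insert.1 hu with rfl | hu
          · simp [hba, hbB] at hbu
          · exact π.eq_of_mem_parts (Finset.mem_of_mem_erase hu) ht hbu hbt)
    (by
      intro h
      rcases Finset.mem_insert.1 h with h | h
      · exact absurd h.symm (Finset.insert_ne_empty a B)
      · exact π.empty_notMem_parts (Finset.mem_of_mem_erase h))

theorem parts_insertInto {s : Finset α} {a : α} (ha : a ∉ s) (π : Finpartition s) (B : Finset α)
    (hB : B ∈ insert ∅ π.parts) :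
    (π.insertInto ha B hB).parts = insert (insert a B) (π.parts.erase B) := rfl

theorem notMem_of_mem_insert_parts {s : Finset α} {a : α} (ha : a ∉ s) {π : Finpartition s}
    {B : Finset α} (hB : B ∈ insert ∅ π.parts) : a ∉ B := by
  rcases Finset.mem_insert.1 hB with rfl | hB
  · simp
  · exact fun h => ha (π.subset hB h)

/-- Deleting `a` from every block undoes the insertion. The outer `erase ∅` removes what is left of
a block `{a}`. -/
theorem image_erase_parts_insertInto {s : Finset α} {a : α} (ha : a ∉ s) (π : Finpartition s)
    (B : Finset α) (hB : B ∈ insert ∅ π.parts) :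
    ((π.insertInto ha B hB).parts.image (·.erase a)).erase ∅ = π.parts := by
  have hid : (π.parts.erase B).image (·.erase a) = π.parts.erase B := by
    refine (Finset.image_congr fun C hC => ?_).trans Finset.image_id
    exact Finset.erase_eq_of_notMem (notMem_of_mem_insert_parts ha
      (Finset.mem_insert_of_mem (Finset.mem_of_mem_erase hC)))
  rw [parts_insertInto, Finset.image_insert, hid,
    Finset.erase_insert (notMem_of_mem_insert_parts ha hB)]
  rcases Finset.mem_insert.1 hB with rfl | hB
  · rw [Finset.erase_insert (Finset.notMem_erase _ _),
      Finset.erase_eq_of_notMem π.empty_notMem_parts]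
  · rw [Finset.insert_erase hB, Finset.erase_eq_of_notMem π.empty_notMem_parts]

theorem insertInto_bijective {s : Finset α} {a : α} (ha : a ∉ s) :
    Function.Bijective (fun x : Σ π : Finpartition s, {B // B ∈ insert ∅ π.parts} =>
      x.1.insertInto ha x.2.1 x.2.2) := by
  refine ⟨?_, fun ψ => ?_⟩
  · rintro ⟨π, B, hB⟩ ⟨π', B', hB'⟩ h
    simp only at h
    obtain rfl : π = π' := Finpartition.ext (by
      rw [← image_erase_parts_insertInto ha π B hB, h, image_erase_parts_insertInto])
    have h1 : insert a B ∈ (π.insertInto ha B' hB').parts := by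
      rw [← h, parts_insertInto]
      exact Finset.mem_insert_self _ _
    have h2 : insert a B' ∈ (π.insertInto ha B' hB').parts := Finset.mem_insert_self _ _
    have h3 := eq_of_mem_parts _ h1 h2 (Finset.mem_insert_self a B) (Finset.mem_insert_self a B')
    have h4 := congrArg (·.erase a) h3
    simp only [Finset.erase_insert (notMem_of_mem_insert_parts ha hB),
      Finset.erase_insert (notMem_of_mem_insert_parts ha hB')] at h4
    subst h4
    rfl
  · set T := ψ.part a with hT
    have hTp : T ∈ ψ.parts := ψ.part_mem.2 (Finset.mem_insert_self a s)
    have haT : a ∈ T := ψ.mem_part_self.2 (Finset.mem_insert_self a s)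
    -- The preimage of `ψ` is its restriction to `s`, with the block of `a` minus `a` as the chosen
    -- block, possibly empty.
    let π : Finpartition s := ψ.restrict (Finset.subset_insert a s)
    have hinter : ∀ C ∈ ψ.parts, C ∩ s = C.erase a := fun C hC => by
      ext b
      have : b ∈ C → b ∈ insert a s := fun h => ψ.subset hC h
      simp only [Finset.mem_insert] at this
      simp only [Finset.mem_inter, Finset.mem_erase]
      constructor
      · rintro ⟨h1, h2⟩
        exact ⟨fun h => ha (h ▸ h2), h1⟩
      · rintro ⟨h1, h2⟩
        exact ⟨h2, (this h2).resolve_left h1⟩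
    have hπ : π.parts = (ψ.parts.image (·.erase a)).erase ∅ := by
      rw [← Finset.image_congr (fun C hC => hinter C hC)]
      rfl
    have hmem : ∀ C, C ≠ T.erase a → (C ∈ π.parts ↔ C ∈ ψ.parts ∧ C ≠ T) := by
      intro C hC
      rw [hπ, Finset.mem_erase, Finset.mem_image]
      constructor
      · rintro ⟨h1, D, hD, rfl⟩
        have haD : a ∉ D := fun h => hC (by rw [ψ.eq_of_mem_parts hD hTp h haT])
        rw [Finset.erase_eq_of_notMem haD]
        exact ⟨hD, fun h => haD (h ▸ haT)⟩
      · rintro ⟨h1, h2⟩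
        exact ⟨ψ.ne_empty h1, C, h1, Finset.erase_eq_of_notMem fun h =>
          h2 (ψ.eq_of_mem_parts h1 hTp h haT)⟩
    have hB : T.erase a ∈ insert ∅ π.parts := by
      by_cases h : T.erase a = ∅
      · simp [h]
      · rw [hπ]
        exact Finset.mem_insert_of_mem (Finset.mem_erase.2 ⟨h, Finset.mem_image_of_mem _ hTp⟩)
    refine ⟨⟨π, T.erase a, hB⟩, Finpartition.ext ?_⟩
    rw [parts_insertInto, Finset.insert_erase haT]
    ext C
    rw [Finset.mem_insert, Finset.mem_erase]
    constructor
    · rintro (rfl | ⟨h1, h2⟩)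
      · exact hTp
      · exact ((hmem C h1).1 h2).1
    · intro hC
      by_cases h : C = T
      · exact Or.inl h
      · have hne : C ≠ T.erase a := by
          rintro rfl
          obtain ⟨b, hb⟩ := ψ.nonempty_of_mem_parts hC
          exact h (ψ.eq_of_mem_parts hC hTp hb (Finset.mem_of_mem_erase hb))
        exact Or.inr ⟨hne, (hmem C hne).2 ⟨hC, h⟩⟩

theorem sum_insert {M : Type*} [AddCommMonoid M] {s : Finset α} {a : α} (ha : a ∉ s)
    (F : Finset (Finset α) → M) :
    ∑ ψ : Finpartition (insert a s), F ψ.parts =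
      ∑ π : Finpartition s, ∑ B ∈ insert ∅ π.parts, F (insert (insert a B) (π.parts.erase B)) := by
  rw [← (insertInto_bijective ha).sum_comp (fun ψ => F ψ.parts), Fintype.sum_sigma]
  refine Finset.sum_congr rfl fun π _ => ?_
  exact Finset.sum_coe_sort (insert ∅ π.parts)
    (fun B => F (insert (insert a B) (π.parts.erase B)))

/-- The number of blocks is on the left because `2 * B.card - 1` is a truncated subtraction; blocks
are nonempty, so nothing is lost. -/
theorem sum_two_mul_card_sub_one {s : Finset α} (π : Finpartition s) :
    ∑ B ∈ π.parts, (2 * B.card - 1) + π.parts.card = 2 * s.card := by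
  rw [← π.sum_card_parts, Finset.mul_sum, Finset.card_eq_sum_ones, ← Finset.sum_add_distrib]
  refine Finset.sum_congr rfl fun B hB => ?_
  have := (π.nonempty_of_mem_parts hB).card_pos
  omega

theorem prod_parts_insert {s : Finset α} {a : α} (ha : a ∉ s) (π : Finpartition s)
    (B : Finset α) (g : Finset α → ℕ) :
    ∏ C ∈ insert (insert a B) (π.parts.erase B), g C =
      g (insert a B) * ∏ C ∈ π.parts.erase B, g C :=
  Finset.prod_insert fun h => ha (π.subset (Finset.mem_of_mem_erase h) (Finset.mem_insert_self a B))

theorem card_parts_insert {s : Finset α} {a : α} (ha : a ∉ s) (π : Finpartition s)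
    (B : Finset α) :
    (insert (insert a B) (π.parts.erase B)).card = (π.parts.erase B).card + 1 :=
  Finset.card_insert_of_notMem fun h =>
    ha (π.subset (Finset.mem_of_mem_erase h) (Finset.mem_insert_self a B))

/-- For a partition of `s` with `k` blocks, a new singleton contributes the factor `q + 1 + k` from
the rising factorial. Joining `B` keeps `k` and contributes `2|B| - 1` from the double factorial.
The sum of all factors is `2|s| - k + q + 1 + k`, independent of the partition. -/
theorem sum_ascFactorial_mul_prod_insert (q : ℕ) {s : Finset α} {a : α} (ha : a ∉ s) :
    ∑ π : Finpartition (insert a s),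
        (q + 1).ascFactorial π.parts.card * ∏ B ∈ π.parts, (2 * B.card - 3)‼ =
      (2 * s.card + 1 + q) * ∑ π : Finpartition s,
        (q + 1).ascFactorial π.parts.card * ∏ B ∈ π.parts, (2 * B.card - 3)‼ := by
  rw [sum_insert ha (fun P => (q + 1).ascFactorial P.card * ∏ B ∈ P, (2 * B.card - 3)‼),
    Finset.mul_sum]
  refine Finset.sum_congr rfl fun π _ => ?_
  rw [Finset.sum_insert π.empty_notMem_parts, prod_parts_insert ha π,
    card_parts_insert ha π, Finset.erase_eq_of_notMem π.empty_notMem_parts]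
  have h : ∀ B ∈ π.parts, (q + 1).ascFactorial (insert (insert a B) (π.parts.erase B)).card *
      ∏ C ∈ insert (insert a B) (π.parts.erase B), (2 * C.card - 3)‼ = (2 * B.card - 1) *
      ((q + 1).ascFactorial π.parts.card * ∏ C ∈ π.parts, (2 * C.card - 3)‼) := by
    intro B hB
    have hpos := (π.nonempty_of_mem_parts hB).card_pos
    rw [prod_parts_insert ha π, card_parts_insert ha π,
      Finset.card_erase_add_one hB, ← Finset.mul_prod_erase _ _ hB,
      Finset.card_insert_of_notMem fun h => ha (π.subset hB h)]
    obtain ⟨b, hb⟩ : ∃ b, B.card = b + 1 := ⟨B.card - 1, by omega⟩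
    -- For `B.card = 1` this reads `1‼ = 1 * 0‼`, by truncation.
    have : (2 * (B.card + 1) - 3)‼ = (2 * B.card - 1) * (2 * B.card - 3)‼ := by
      rw [hb]
      cases b with
      | zero => simp
      | succ b => exact Nat.doubleFactorial_add_two (2 * b + 1)
    rw [this]
    ring
  rw [Finset.sum_congr rfl h, ← Finset.sum_mul, ← π.sum_two_mul_card_sub_one,
    Nat.ascFactorial_succ]
  simp
  ring

theorem sum_ascFactorial_mul_prod (q : ℕ) (s : Finset α) :
    ∑ π : Finpartition s, (q + 1).ascFactorial π.parts.card * ∏ B ∈ π.parts, (2 * B.card - 3)‼ =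
      ∏ i ∈ Finset.range s.card, (2 * i + 1 + q) := by
  induction s using Finset.induction_on with
  | empty =>
    have : Unique (Finpartition (∅ : Finset α)) :=
      inferInstanceAs (Unique (Finpartition (⊥ : Finset α)))
    have h : ∀ π : Finpartition (∅ : Finset α), π.parts = ∅ := fun π =>
      π.parts_eq_empty_iff.2 rfl
    simp [h]
  | insert a s ha ih =>
    rw [sum_ascFactorial_mul_prod_insert q ha, ih, Finset.card_insert_of_notMem ha,
      Finset.prod_range_succ, mul_comm]

end Finpartition

theorem partitionSum_typeCWeight (n m : ℕ) (hm : 2 ≤ m) :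
    partitionSum n (typeCWeight m) = ∏ i ∈ Finset.range n, (2 * i + 1 + (m - 2)) := by
  obtain ⟨q, rfl⟩ : ∃ q, m = q + 2 := ⟨m - 2, by omega⟩
  have h := Finpartition.sum_ascFactorial_mul_prod q (Finset.univ : Finset (Fin n))
  rw [Finset.card_univ, Fintype.card_fin] at h
  rw [Nat.add_sub_cancel, ← h]
  refine Finset.sum_congr rfl fun π _ => ?_
  congr 1
  rw [typeCWeight, Nat.ascFactorial_eq_div]
  congr 2
  · omega

/-! ## Labeled partitions, pointwise -/

namespace BarredSet

variable {n : ℕ}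

/-- The involution `i ↔ ī`. -/
def flip (a : BarredSet n) : BarredSet n := (a.1, !a.2)

@[simp] theorem flip_flip (a : BarredSet n) : flip (flip a) = a := by simp [flip]

@[simp] theorem flip_fst (a : BarredSet n) : (flip a).1 = a.1 := rfl

theorem flip_ne (a : BarredSet n) : flip a ≠ a := fun h => by
  have := congrArg Prod.snd h
  simp [flip] at this

@[simp] theorem flip_mk (i : Fin n) (o : Bool) : flip (i, o) = (i, !o) := rfl

theorem flip_mem_bar {X : Finset (BarredSet n)} {a : BarredSet n} : flip a ∈ bar X ↔ a ∈ X := by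
  rw [mem_bar]
  simp [flip]

end BarredSet

namespace LabeledPartition

variable {n : ℕ} {S : Type*} (x y : LabeledPartition n S)

/-- Two elements lie in the same block. -/
def Rel (a b : BarredSet n) : Prop := x.partition.part a = x.partition.part b

/-- The sign of the block of an element. -/
def sgn (a : BarredSet n) : Option S := x.sign (x.partition.part a)

variable {x y}

theorem Rel.refl (a : BarredSet n) : x.Rel a a := rfl

theorem Rel.symm {a b : BarredSet n} (h : x.Rel a b) : x.Rel b a := Eq.symm h

theorem Rel.trans {a b c : BarredSet n} (h : x.Rel a b) (h' : x.Rel b c) : x.Rel a c :=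
  Eq.trans h h'

theorem Rel.sgn_eq {a b : BarredSet n} (h : x.Rel a b) : x.sgn a = x.sgn b := congrArg x.sign h

variable (x) in
theorem part_mem_parts (a : BarredSet n) : x.partition.part a ∈ x.partition.parts :=
  x.partition.part_mem.2 (Finset.mem_univ a)

theorem mem_part {a b : BarredSet n} : b ∈ x.partition.part a ↔ x.Rel b a :=
  x.partition.mem_part_iff_part_eq_part (Finset.mem_univ _) (Finset.mem_univ _)

theorem part_flip (a : BarredSet n) : x.partition.part (flip a) = bar (x.partition.part a) :=
  x.partition.part_eq_of_mem (x.bar_mem _ (x.part_mem_parts a))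
    (flip_mem_bar.2 (mem_part.2 (Rel.refl a)))

theorem Rel.flip {a b : BarredSet n} (h : x.Rel a b) : x.Rel (flip a) (flip b) := by
  unfold Rel at *
  rw [part_flip, part_flip, h]

theorem isSome_sgn_iff {a : BarredSet n} : (x.sgn a).isSome ↔ x.Rel a (BarredSet.flip a) := by
  rw [sgn, x.isSome_sign_iff, Rel, part_flip]
  exact ⟨fun h => h.2.symm, fun h => ⟨x.part_mem_parts a, h.symm⟩⟩

theorem sgn_eq_none_iff {a : BarredSet n} : x.sgn a = none ↔ ¬x.Rel a (BarredSet.flip a) := by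
  rw [← isSome_sgn_iff]
  simp

theorem sgn_flip (a : BarredSet n) : x.sgn (BarredSet.flip a) = x.sgn a := by
  cases h : x.sgn a with
  | some σ => exact (isSome_sgn_iff.1 (by simp [h])).symm.sgn_eq.trans h
  | none =>
    rw [sgn_eq_none_iff] at h ⊢
    intro h'
    exact h (by simpa using h'.symm)

theorem rel_of_sgn_eq {a b : BarredSet n} {σ : S} (ha : x.sgn a = some σ)
    (hb : x.sgn b = some σ) : x.Rel a b := x.sign_injective _ _ σ ha hb

theorem exists_part_eq {R : Finset (BarredSet n)} (hR : R ∈ x.partition.parts) :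
    ∃ a, R = x.partition.part a := by
  obtain ⟨a, ha⟩ := x.partition.nonempty_of_mem_parts hR
  exact ⟨a, (x.partition.part_eq_of_mem hR ha).symm⟩

theorem mem_signs {σ : S} : σ ∈ x.signs ↔ ∃ a, x.sgn a = some σ := by
  constructor
  · rintro ⟨R, hR⟩
    obtain ⟨a, rfl⟩ := exists_part_eq (mem_parts_of_sign hR)
    exact ⟨a, hR⟩
  · rintro ⟨a, ha⟩
    exact ⟨_, ha⟩

theorem mem_signedBlock {σ : S} {a : BarredSet n} : a ∈ x.signedBlock σ ↔ x.sgn a = some σ := by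
  constructor
  · rintro ⟨R, hR, ha⟩
    rw [← x.partition.part_eq_of_mem (mem_parts_of_sign hR) ha] at hR
    exact hR
  · exact fun h => ⟨_, h, mem_part.2 (Rel.refl a)⟩

theorem isUnsignedBlock_part {a : BarredSet n} :
    x.IsUnsignedBlock (x.partition.part a) ↔ x.sgn a = none :=
  ⟨And.right, fun h => ⟨x.part_mem_parts a, h⟩⟩

/-- Refinement can be tested on elements. The clause on barred blocks is automatic, since blocks are
closed under `bar`. -/
theorem le_iff : x ≤ y ↔ (∀ a b, x.Rel a b → y.Rel a b) ∧
    ∀ a σ, x.sgn a = some σ → y.sgn a = some σ := by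
  constructor
  · intro h
    change x.Refines y at h
    refine ⟨fun a b hab => ?_, fun a σ ha => ?_⟩
    · obtain ⟨T, hT, hsub⟩ := h.exists_block (x.part_mem_parts b)
      have ha := hsub (mem_part.2 hab)
      have hb := hsub (mem_part.2 (Rel.refl b))
      exact (y.partition.part_eq_of_mem hT ha).trans (y.partition.part_eq_of_mem hT hb).symm
    · rw [← mem_signedBlock] at ha ⊢
      exact (h.1 σ (mem_signs.2 ⟨a, mem_signedBlock.1 ha⟩)).2 ha
  · rintro ⟨h1, h2⟩
    refine ⟨fun σ hσ => ⟨?_, fun a ha => ?_⟩, fun R hR => ?_⟩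
    · rw [mem_signs] at hσ ⊢
      exact hσ.imp fun a => h2 a σ
    · rw [mem_signedBlock] at ha ⊢
      exact h2 a σ ha
    · obtain ⟨a, rfl⟩ := exists_part_eq hR.1
      have hsub : x.partition.part a ⊆ y.partition.part a := fun b hb =>
        mem_part.2 (h1 b a (mem_part.1 hb))
      exact ⟨_, y.part_mem_parts a, y.bar_mem _ (y.part_mem_parts a), hsub, bar_mono hsub⟩

theorem rel_mono (h : x ≤ y) {a b : BarredSet n} (hab : x.Rel a b) : y.Rel a b :=
  (le_iff.1 h).1 a b hab

theorem sgn_mono (h : x ≤ y) {a : BarredSet n} {σ : S} (ha : x.sgn a = some σ) :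
    y.sgn a = some σ := (le_iff.1 h).2 a σ ha

theorem sgn_eq_none_of_le (h : x ≤ y) {a : BarredSet n} (ha : y.sgn a = none) :
    x.sgn a = none := by
  cases hs : x.sgn a with
  | none => rfl
  | some σ => rw [sgn_mono h hs] at ha; exact absurd ha (by simp)

/-! ### Representatives of the unsigned blocks -/

open Classical in
variable (x) in
/-- The representatives (shifted by one) of the unsigned blocks. -/
noncomputable def reps : Finset (Fin n) :=
  Finset.univ.filter fun i => x.sgn (i, false) = none ∧ ∀ b, x.Rel (i, false) b → i ≤ b.1

theorem mem_reps {i : Fin n} :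
    i ∈ x.reps ↔ x.sgn (i, false) = none ∧ ∀ b, x.Rel (i, false) b → i ≤ b.1 := by
  simp [reps]

theorem sgn_eq_none_of_mem_reps {i : Fin n} (hi : i ∈ x.reps) (o : Bool) :
    x.sgn (i, o) = none := by
  have h := (mem_reps.1 hi).1
  cases o with
  | false => exact h
  | true => rw [← h, ← sgn_flip]; rfl

theorem le_of_mem_reps {i : Fin n} (hi : i ∈ x.reps) {o : Bool} {b : BarredSet n}
    (h : x.Rel (i, o) b) : i ≤ b.1 := by
  have h' := (mem_reps.1 hi).2
  cases o with
  | false => exact h' b h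
  | true => exact h' (BarredSet.flip b) (Rel.flip h)

theorem mem_reps_of {i : Fin n} {o : Bool} (h : x.sgn (i, o) = none)
    (h' : ∀ b, x.Rel (i, o) b → i ≤ b.1) : i ∈ x.reps := by
  refine mem_reps.2 ?_
  cases o with
  | false => exact ⟨h, h'⟩
  | true =>
    refine ⟨by rw [← h, ← sgn_flip]; rfl, fun b hb => h' (BarredSet.flip b) (Rel.flip hb)⟩

theorem exists_rep {a : BarredSet n} (ha : x.sgn a = none) : ∃ b, b.1 ∈ x.reps ∧ x.Rel a b := by
  obtain ⟨b, hb, hmin⟩ := Finset.exists_min_image (x.partition.part a) Prod.fst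
    ⟨a, mem_part.2 (Rel.refl a)⟩
  rw [mem_part] at hb
  refine ⟨b, mem_reps_of (o := b.2) (hb.sgn_eq.trans ha) fun c hc => ?_, hb.symm⟩
  exact hmin c (mem_part.2 (Rel.trans (Rel.symm hc) hb))

/-- Minimality gives equal indices, and `c = flip b` is impossible because then the block would be
signed. -/
theorem rep_unique {b c : BarredSet n} (hb : b.1 ∈ x.reps) (hc : c.1 ∈ x.reps)
    (h : x.Rel b c) : b = c := by
  have h1 : b.1 = c.1 := le_antisymm (le_of_mem_reps (o := b.2) hb h)
    (le_of_mem_reps (o := c.2) hc h.symm)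
  refine Prod.ext h1 ?_
  by_contra h2
  have h3 : c = BarredSet.flip b := Prod.ext h1.symm (by
    change c.2 = !b.2
    cases hc : c.2 <;> cases hb : b.2 <;> simp_all)
  exact sgn_eq_none_iff.1 (sgn_eq_none_of_mem_reps hb b.2) (h3 ▸ h)

theorem reps_anti (h : x ≤ y) : y.reps ⊆ x.reps := fun _ hi =>
  mem_reps_of (o := false) (sgn_eq_none_of_le h (sgn_eq_none_of_mem_reps hi false))
    fun _ hb => le_of_mem_reps hi (rel_mono h hb)

/-- This makes `reps` strictly decreasing along `<`, so its cardinality serves as a rank. Going up,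
an unsigned block either keeps its representative or gets absorbed; if no representative is lost,
nothing has been merged or signed. -/
theorem eq_of_le_of_reps_subset (h : x ≤ y) (h' : x.reps ⊆ y.reps) : x = y := by
  have key : ∀ a, x.sgn a = none → y.sgn a = none ∧ ∃ b, b.1 ∈ y.reps ∧ x.Rel a b := by
    intro a ha
    obtain ⟨b, hb, hab⟩ := exists_rep ha
    exact ⟨(rel_mono h hab).sgn_eq.trans (sgn_eq_none_of_mem_reps (h' hb) b.2), b, h' hb, hab⟩
  have hsgn : ∀ a σ, y.sgn a = some σ → x.sgn a = some σ := by
    intro a σ ha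
    cases hs : x.sgn a with
    | none => rw [(key a hs).1] at ha; exact absurd ha (by simp)
    | some τ => rw [← ha, sgn_mono h hs]
  refine le_antisymm h (le_iff.2 ⟨fun a b hab => ?_, hsgn⟩)
  cases hs : y.sgn a with
  | some σ => exact rel_of_sgn_eq (hsgn a σ hs) (hsgn b σ (hab.sgn_eq.symm.trans hs))
  | none =>
    obtain ⟨-, c, hc, hac⟩ := key a (sgn_eq_none_of_le h hs)
    obtain ⟨-, d, hd, hbd⟩ := key b (sgn_eq_none_of_le h (hab.sgn_eq.symm.trans hs))
    have : c = d := rep_unique hc hd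
      ((rel_mono h hac).symm.trans (hab.trans (rel_mono h hbd)))
    exact hac.trans (this ▸ hbd.symm)

/-! ### Normal forms of elements -/

/-- `Near a v` says that `a` lies in the block described by `v`: a sign, or an element. -/
def Near (x : LabeledPartition n S) (a : BarredSet n) : S ⊕ BarredSet n → Prop
  | .inl σ => x.sgn a = some σ
  | .inr b => x.Rel a b

/-- The involution, acting trivially on signs. -/
def sumFlip : S ⊕ BarredSet n → S ⊕ BarredSet n := Sum.map id BarredSet.flip

@[simp] theorem sumFlip_inl (σ : S) : sumFlip (.inl σ : S ⊕ BarredSet n) = .inl σ := rfl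

@[simp] theorem sumFlip_inr (b : BarredSet n) :
    sumFlip (.inr b : S ⊕ BarredSet n) = .inr (BarredSet.flip b) := rfl

@[simp] theorem sumFlip_sumFlip (v : S ⊕ BarredSet n) : sumFlip (sumFlip v) = v := by
  cases v <;> simp

theorem Near.sumFlip {a : BarredSet n} {v : S ⊕ BarredSet n} (h : x.Near a v) :
    x.Near (BarredSet.flip a) (sumFlip v) := by
  cases v with
  | inl σ => exact (sgn_flip a).trans h
  | inr b => exact Rel.flip h

theorem Near.trans {a b : BarredSet n} {v : S ⊕ BarredSet n} (h : x.Rel a b) (hb : x.Near b v) :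
    x.Near a v := by
  cases v with
  | inl σ => exact h.sgn_eq.trans hb
  | inr b => exact Rel.trans h hb

theorem Near.rel {a b : BarredSet n} {v : S ⊕ BarredSet n} (ha : x.Near a v) (hb : x.Near b v) :
    x.Rel a b := by
  cases v with
  | inl σ => exact rel_of_sgn_eq ha hb
  | inr c => exact Rel.trans ha (Rel.symm hb)

/-- A normal form: signs, and the elements `i`, `ī` for `i` the representative of an unsigned
block. -/
def IsReduced (x : LabeledPartition n S) (v : S ⊕ BarredSet n) : Prop :=
  ∀ b, v = .inr b → b.1 ∈ x.reps

theorem exists_code (x : LabeledPartition n S) (a : BarredSet n) :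
    ∃ v, x.IsReduced v ∧ x.Near a v := by
  cases hs : x.sgn a with
  | some σ => exact ⟨.inl σ, fun b hb => by simp at hb, hs⟩
  | none =>
    obtain ⟨b, hb, hab⟩ := exists_rep hs
    exact ⟨.inr b, fun c hc => by obtain rfl := Sum.inr_injective hc; exact hb, hab⟩

/-- The normal form of an element. -/
noncomputable def code (x : LabeledPartition n S) (a : BarredSet n) : S ⊕ BarredSet n :=
  (exists_code x a).choose

theorem isReduced_code (x : LabeledPartition n S) (a : BarredSet n) : x.IsReduced (x.code a) :=
  (exists_code x a).choose_spec.1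

theorem near_code (x : LabeledPartition n S) (a : BarredSet n) : x.Near a (x.code a) :=
  (exists_code x a).choose_spec.2

theorem IsReduced.eq {v w : S ⊕ BarredSet n} (hv : x.IsReduced v) (hw : x.IsReduced w)
    {a : BarredSet n} (h : x.Near a v) (h' : x.Near a w) : v = w := by
  rcases v with σ | b <;> rcases w with τ | c
  · exact congrArg _ (Option.some_injective _ ((Eq.symm h).trans h'))
  · have := (Rel.sgn_eq h').symm.trans h
    rw [show x.sgn c = none from sgn_eq_none_of_mem_reps (hw c rfl) c.2] at this
    exact absurd this (by simp)
  · have := (Rel.sgn_eq h).symm.trans h'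
    rw [show x.sgn b = none from sgn_eq_none_of_mem_reps (hv b rfl) b.2] at this
    exact absurd this (by simp)
  · exact congrArg _ (rep_unique (hv b rfl) (hw c rfl) (Rel.trans (Rel.symm h) h'))

theorem code_eq_iff {v : S ⊕ BarredSet n} (hv : x.IsReduced v) {a : BarredSet n} :
    x.code a = v ↔ x.Near a v :=
  ⟨fun h => h ▸ near_code x a, fun h => (isReduced_code x a).eq hv (near_code x a) h⟩

theorem isReduced_inl (x : LabeledPartition n S) (σ : S) : x.IsReduced (.inl σ) :=
  fun b hb => by simp at hb

theorem isReduced_inr {b : BarredSet n} : x.IsReduced (.inr b) ↔ b.1 ∈ x.reps :=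
  ⟨fun h => h b rfl, fun h c hc => by obtain rfl := Sum.inr_injective hc; exact h⟩

theorem IsReduced.sumFlip {v : S ⊕ BarredSet n} (hv : x.IsReduced v) :
    x.IsReduced (sumFlip v) := by
  cases v with
  | inl σ => exact isReduced_inl x σ
  | inr b => exact isReduced_inr.2 (isReduced_inr (b := b).1 hv)

theorem code_flip (a : BarredSet n) : x.code (BarredSet.flip a) = sumFlip (x.code a) :=
  (code_eq_iff (isReduced_code x a).sumFlip).2 (near_code x a).sumFlip

theorem code_eq_inl_iff {a : BarredSet n} {σ : S} : x.code a = .inl σ ↔ x.sgn a = some σ :=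
  code_eq_iff (isReduced_inl x σ)

theorem code_eq_code_iff {a b : BarredSet n} : x.code a = x.code b ↔ x.Rel a b :=
  ⟨fun h => (near_code x a).rel (h ▸ near_code x b), fun h =>
    (code_eq_iff (isReduced_code x b)).2 (Near.trans h (near_code x b))⟩

theorem code_of_mem_reps {i : Fin n} (hi : i ∈ x.reps) (o : Bool) :
    x.code (i, o) = .inr (i, o) :=
  (code_eq_iff (isReduced_inr.2 hi)).2 (Rel.refl _)

/-! ### Labeled partitions as fibers of equivariant functions -/

section OfFun

variable (f : BarredSet n → S ⊕ BarredSet n)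

open Classical in
/-- The partition of `[[n]]` into the fibers of a function. -/
noncomputable def fibers : Finpartition (Finset.univ : Finset (BarredSet n)) :=
  Finpartition.ofSetoid (Setoid.ker f)

theorem mem_part_fibers {a b : BarredSet n} : b ∈ (fibers f).part a ↔ f a = f b := by
  classical
  rw [fibers, Finpartition.mem_part_ofSetoid_iff_rel]
  rfl

theorem part_fibers_eq_iff {a b : BarredSet n} :
    (fibers f).part a = (fibers f).part b ↔ f a = f b := by
  rw [← mem_part_fibers, (fibers f).mem_part_iff_part_eq_part (Finset.mem_univ _)
    (Finset.mem_univ _), eq_comm]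

theorem exists_part_fibers_eq {R : Finset (BarredSet n)} (hR : R ∈ (fibers f).parts) :
    ∃ a, R = (fibers f).part a := by
  obtain ⟨a, ha⟩ := (fibers f).nonempty_of_mem_parts hR
  exact ⟨a, ((fibers f).part_eq_of_mem hR ha).symm⟩

theorem bar_part_fibers (hf : ∀ a, f (BarredSet.flip a) = sumFlip (f a))
    (a : BarredSet n) :
    bar ((fibers f).part a) = (fibers f).part (BarredSet.flip a) := by
  ext b
  rw [mem_bar, mem_part_fibers, mem_part_fibers, hf a]
  change f a = f (BarredSet.flip b) ↔ _
  rw [hf b]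
  constructor
  · intro h
    rw [h, sumFlip_sumFlip]
  · intro h
    rw [← h, sumFlip_sumFlip]

open Classical in
/-- The sign of a fiber over a sign. -/
noncomputable def fiberSign (R : Finset (BarredSet n)) : Option S :=
  if h : ∃ σ, ∃ a, f a = .inl σ ∧ R = (fibers f).part a then some h.choose else none

theorem fiberSign_eq_some_iff {R : Finset (BarredSet n)} {σ : S} :
    fiberSign f R = some σ ↔ ∃ a, f a = .inl σ ∧ R = (fibers f).part a := by
  unfold fiberSign
  constructor
  · intro h
    split_ifs at h with h'
    obtain rfl := Option.some_injective _ h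
    exact h'.choose_spec
  · rintro ⟨a, ha, rfl⟩
    have h' : ∃ σ, ∃ b, f b = .inl σ ∧ (fibers f).part a = (fibers f).part b := ⟨σ, a, ha, rfl⟩
    rw [dif_pos h']
    obtain ⟨b, hb, hab⟩ := h'.choose_spec
    rw [part_fibers_eq_iff, ha, hb] at hab
    rw [Sum.inl_injective hab]

/-- The labeled partition whose blocks are the fibers of an equivariant function, with the fiber
over a sign labeled by this sign. -/
noncomputable def ofFun (hf : ∀ a, f (BarredSet.flip a) = sumFlip (f a)) :
    LabeledPartition n S where
  partition := fibers f
  sign := fiberSign f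
  bar_mem R hR := by
    obtain ⟨a, rfl⟩ := exists_part_fibers_eq f hR
    rw [bar_part_fibers f hf, (fibers f).part_mem]
    exact Finset.mem_univ _
  isSome_sign_iff R := by
    rw [Option.isSome_iff_exists]
    simp only [fiberSign_eq_some_iff]
    constructor
    · rintro ⟨σ, a, ha, rfl⟩
      refine ⟨(fibers f).part_mem.2 (Finset.mem_univ a), ?_⟩
      rw [bar_part_fibers f hf, part_fibers_eq_iff, hf, ha, sumFlip_inl]
    · rintro ⟨hR, hbar⟩
      obtain ⟨a, rfl⟩ := exists_part_fibers_eq f hR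
      rw [bar_part_fibers f hf, part_fibers_eq_iff, hf] at hbar
      cases h : f a with
      | inl σ => exact ⟨σ, a, h, rfl⟩
      | inr b =>
        rw [h, sumFlip_inr] at hbar
        exact absurd (Sum.inr_injective hbar) (flip_ne b)
  sign_injective R R' σ h h' := by
    obtain ⟨a, ha, rfl⟩ := (fiberSign_eq_some_iff f).1 h
    obtain ⟨b, hb, rfl⟩ := (fiberSign_eq_some_iff f).1 h'
    rw [part_fibers_eq_iff, ha, hb]

theorem rel_ofFun (hf : ∀ a, f (BarredSet.flip a) = sumFlip (f a)) {a b : BarredSet n} :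
    (ofFun f hf).Rel a b ↔ f a = f b :=
  part_fibers_eq_iff f

theorem sgn_ofFun (hf : ∀ a, f (BarredSet.flip a) = sumFlip (f a))
    {a : BarredSet n} {σ : S} : (ofFun f hf).sgn a = some σ ↔ f a = .inl σ := by
  refine (fiberSign_eq_some_iff f).trans ⟨?_, fun h => ⟨a, h, rfl⟩⟩
  rintro ⟨b, hb, hab⟩
  exact ((part_fibers_eq_iff f).1 hab).trans hb

end OfFun

/-! ## Elementary merges and covers -/

/-- Send `q` to `t`, and `q̄` to `t̄`. -/
def move (q : Fin n) (t : S ⊕ BarredSet n) : S ⊕ BarredSet n → S ⊕ BarredSet n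
  | .inl σ => .inl σ
  | .inr b => if b.1 = q then (if b.2 then sumFlip t else t) else .inr b

theorem move_sumFlip (q : Fin n) (t v : S ⊕ BarredSet n) :
    move q t (sumFlip v) = sumFlip (move q t v) := by
  rcases v with σ | ⟨i, o⟩
  · rfl
  · by_cases h : i = q <;> cases o <;> simp [move, h]

theorem move_of_ne {q : Fin n} {t : S ⊕ BarredSet n} {b : BarredSet n} (h : b.1 ≠ q) :
    move q t (.inr b) = .inr b := by
  simp [move, h]

theorem move_self (q : Fin n) (t : S ⊕ BarredSet n) : move q t (.inr (q, false)) = t := by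
  simp [move]

theorem move_self_true (q : Fin n) (t : S ⊕ BarredSet n) :
    move q t (.inr (q, true)) = sumFlip t := by
  simp [move]

/-- The labeled partition obtained from `x` by merging the block of `q` into the one described
by `t`. -/
noncomputable def merge (x : LabeledPartition n S) (q : Fin n) (t : S ⊕ BarredSet n) :
    LabeledPartition n S :=
  ofFun (fun a => move q t (x.code a)) fun a => by rw [code_flip, move_sumFlip]

theorem rel_merge {q : Fin n} {t : S ⊕ BarredSet n} {a b : BarredSet n} :
    (x.merge q t).Rel a b ↔ move q t (x.code a) = move q t (x.code b) := rel_ofFun _ _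

theorem sgn_merge {q : Fin n} {t : S ⊕ BarredSet n} {a : BarredSet n} {σ : S} :
    (x.merge q t).sgn a = some σ ↔ move q t (x.code a) = .inl σ := sgn_ofFun _ _

theorem le_merge (x : LabeledPartition n S) (q : Fin n) (t : S ⊕ BarredSet n) :
    x ≤ x.merge q t := by
  refine le_iff.2 ⟨fun a b h => ?_, fun a σ h => ?_⟩
  · rw [rel_merge, code_eq_code_iff.2 h]
  · rw [sgn_merge, code_eq_inl_iff.2 h]
    rfl

/-- Universal property of the merge: if `y` already puts `q` into the block of `t`, then moving the
code of an element does not leave its block in `y`. -/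
theorem merge_le {q : Fin n} {t : S ⊕ BarredSet n} (h : x ≤ y) (ht : y.Near (q, false) t) :
    x.merge q t ≤ y := by
  have key : ∀ a, y.Near a (move q t (x.code a)) := by
    intro a
    have ha := near_code x a
    rcases hv : x.code a with σ | ⟨i, o⟩ <;> rw [hv] at ha
    · exact sgn_mono h ha
    · have hr : y.Rel a (i, o) := rel_mono h ha
      by_cases hi : i = q
      · subst hi
        refine Near.trans hr ?_
        cases o
        · rwa [move_self]
        · rw [move_self_true]
          exact ht.sumFlip
      · rwa [move_of_ne (by exact hi)]
  refine le_iff.2 ⟨fun a b hab => ?_, fun a σ ha => ?_⟩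
  · rw [rel_merge] at hab
    exact (key a).rel (hab ▸ key b)
  · rw [sgn_merge] at ha
    have := key a
    rwa [ha] at this

/-- The block of `q` can be merged into `t`: a sign, or the block of a smaller representative. -/
def IsTarget (x : LabeledPartition n S) (q : Fin n) (t : S ⊕ BarredSet n) : Prop :=
  ∀ b, t = .inr b → b.1 ∈ x.reps ∧ b.1 < q

theorem near_merge {q : Fin n} {t : S ⊕ BarredSet n} (hq : q ∈ x.reps) (ht : x.IsTarget q t) :
    (x.merge q t).Near (q, false) t := by
  cases t with
  | inl σ =>
    exact sgn_merge.2 (by rw [code_of_mem_reps hq, move_self])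
  | inr b =>
    obtain ⟨hb, hbq⟩ := ht b rfl
    refine rel_merge.2 ?_
    rw [code_of_mem_reps hq, move_self, code_of_mem_reps hb b.2, move_of_ne hbq.ne]

/-- The target is a sign or has a smaller representative, so the enlarged block keeps its sign or
its minimum. -/
theorem reps_merge {q : Fin n} {t : S ⊕ BarredSet n} (hq : q ∈ x.reps) (ht : x.IsTarget q t) :
    (x.merge q t).reps = x.reps.erase q := by
  ext i
  rw [Finset.mem_erase]
  constructor
  · intro hi
    refine ⟨?_, reps_anti (le_merge x q t) hi⟩
    rintro rfl
    have hnear := near_merge hq ht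
    cases t with
    | inl σ =>
      have : (x.merge i (.inl σ)).sgn (i, false) = some σ := hnear
      rw [sgn_eq_none_of_mem_reps hi] at this
      exact absurd this (by simp)
    | inr b => exact absurd (le_of_mem_reps hi hnear) (not_le.2 (ht b rfl).2)
  · rintro ⟨hiq, hi⟩
    have hm : move q t (x.code (i, false)) = .inr (i, false) := by
      rw [code_of_mem_reps hi, move_of_ne hiq]
    refine mem_reps_of (o := false) ?_ fun b hb => ?_
    · cases hs : (x.merge q t).sgn (i, false) with
      | none => rfl
      | some σ =>
        rw [sgn_merge, hm] at hs
        exact absurd hs (by simp)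
    · rw [rel_merge, hm] at hb
      have hnb := near_code x b
      have hred := isReduced_code x b
      rcases hc : x.code b with σ | c <;> rw [hc] at hb hnb hred
      · exact absurd hb (by simp [move])
      · have hcb : c.1 ≤ b.1 := le_of_mem_reps (o := c.2) (isReduced_inr.1 hred) (Rel.symm hnb)
        by_cases hcq : c.1 = q
        -- Here `b` comes from the block of `q` or its bar and ends up with `i`, so the target is
        -- `i` or its bar, and `i < q ≤ b.1`.
        · have hex : ∃ o, t = .inr (i, o) := by
            obtain ⟨c1, c2⟩ := c
            simp only at hcq
            subst hcq
            cases c2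
            · rw [move_self] at hb
              exact ⟨_, hb.symm⟩
            · rw [move_self_true] at hb
              exact ⟨true, by rw [← sumFlip_sumFlip t, ← hb]; rfl⟩
          obtain ⟨o, rfl⟩ := hex
          exact (ht _ rfl).2.le.trans (hcq ▸ hcb)
        · rw [move_of_ne hcq] at hb
          obtain rfl := Sum.inr_injective hb
          exact hcb

/-- Some representative `q` of `x` is lost in `y`. The target is the normal form of `q` in `y`; if
it is an element, its index is smaller than `q`, as `q` is no longer a representative. -/
theorem exists_merge_le (h : x < y) :
    ∃ q ∈ x.reps, ∃ t, x.IsTarget q t ∧ x.merge q t ≤ y := by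
  obtain ⟨q, hq, hqy⟩ := Finset.not_subset.1 fun h' => h.ne (eq_of_le_of_reps_subset h.le h')
  obtain ⟨t, hred, hnear⟩ := exists_code y (q, false)
  refine ⟨q, hq, t, ?_, merge_le h.le hnear⟩
  rintro b rfl
  have hb := isReduced_inr.1 hred
  refine ⟨reps_anti h.le hb, lt_of_le_of_ne (le_of_mem_reps (o := b.2) hb (Rel.symm hnear)) ?_⟩
  rintro rfl
  exact hqy hb

theorem card_reps_lt (h : x < y) : y.reps.card < x.reps.card :=
  Finset.card_lt_card ⟨reps_anti h.le, fun h' => h.ne (eq_of_le_of_reps_subset h.le h')⟩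

theorem covBy_merge {q : Fin n} {t : S ⊕ BarredSet n} (hq : q ∈ x.reps) (ht : x.IsTarget q t) :
    x ⋖ x.merge q t := by
  have hcard : (x.merge q t).reps.card + 1 = x.reps.card := by
    rw [reps_merge hq ht, Finset.card_erase_add_one hq]
  refine ⟨lt_of_le_of_ne (le_merge x q t) fun h => ?_, fun z hz hz' => ?_⟩
  · rw [← h] at hcard
    omega
  · have := card_reps_lt hz
    have := card_reps_lt hz'
    omega

theorem covBy_iff : x ⋖ y ↔ ∃ q ∈ x.reps, ∃ t, x.IsTarget q t ∧ x.merge q t = y := by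
  constructor
  · intro h
    obtain ⟨q, hq, t, ht, hle⟩ := exists_merge_le h.lt
    exact ⟨q, hq, t, ht, eq_of_le_of_not_lt hle (h.2 (covBy_merge hq ht).lt)⟩
  · rintro ⟨q, hq, t, ht, rfl⟩
    exact covBy_merge hq ht

/-- The merge remembers `q` as the lost representative and `t` as the normal form of `q` in the new
partition. -/
theorem merge_injective {q q' : Fin n} {t t' : S ⊕ BarredSet n} (hq : q ∈ x.reps)
    (ht : x.IsTarget q t) (hq' : q' ∈ x.reps) (ht' : x.IsTarget q' t')
    (h : x.merge q t = x.merge q' t') : q = q' ∧ t = t' := by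
  obtain rfl : q = q' := by
    by_contra hne
    have h1 := reps_merge hq ht
    rw [h, reps_merge hq' ht'] at h1
    have : q ∈ x.reps.erase q' := Finset.mem_erase.2 ⟨hne, hq⟩
    rw [h1] at this
    exact Finset.notMem_erase q _ this
  have hred : ∀ {t}, x.IsTarget q t → (x.merge q t).IsReduced t := fun {t} ht b hb => by
    rw [reps_merge hq ht, Finset.mem_erase]
    exact ⟨(ht b hb).2.ne, (ht b hb).1⟩
  exact ⟨rfl, (hred ht).eq (h ▸ hred ht') (near_merge hq ht) (h ▸ near_merge hq ht')⟩

end LabeledPartition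

/-! ## The labels of elementary merges -/

namespace LabeledPartition

variable {n : ℕ} {S : Type*} {x : LabeledPartition n S}

theorem move_eq_inl_iff {q : Fin n} {t v : S ⊕ BarredSet n} {σ : S} :
    move q t v = .inl σ ↔ v = .inl σ ∨ (t = .inl σ ∧ ∃ o, v = .inr (q, o)) := by
  rcases v with τ | ⟨i, o⟩
  · simp [move]
  · by_cases h : i = q
    · subst h
      rcases t with τ | c <;> cases o <;> simp [move]
    · simp [move, h]

theorem isOfSign_merge_iff {q : Fin n} (hq : q ∈ x.reps) {t : S ⊕ BarredSet n} {σ : S} :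
    IsOfSign x (x.merge q t) σ ↔ t = .inl σ := by
  have hsub : x.signedBlock σ ⊆ (x.merge q t).signedBlock σ := fun a ha => by
    rw [mem_signedBlock] at ha ⊢
    exact sgn_mono (le_merge x q t) ha
  rw [IsOfSign, Set.ssubset_iff_of_subset hsub]
  simp only [mem_signedBlock, sgn_merge, move_eq_inl_iff, code_eq_inl_iff]
  constructor
  · rintro ⟨a, h | h, h'⟩
    · exact absurd h h'
    · exact h.1
  · intro h
    refine ⟨(q, false), Or.inr ⟨h, false, code_of_mem_reps hq false⟩, ?_⟩
    simp [sgn_eq_none_of_mem_reps hq]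

theorem label_merge_inl [LinearOrder S] {q : Fin n} (hq : q ∈ x.reps) (σ : S) :
    label x (x.merge q (.inl σ)) = signedLabel x σ := by
  have h : ∃ τ, IsOfSign x (x.merge q (.inl σ)) τ := ⟨σ, (isOfSign_merge_iff hq).2 rfl⟩
  rw [label, dif_pos h, ← Sum.inl_injective ((isOfSign_merge_iff hq).1 h.choose_spec)]

theorem rep_part {i : Fin n} (hi : i ∈ x.reps) (o : Bool) :
    rep (x.partition.part (i, o)) = (i : ℕ) + 1 := by
  have hmem : (i : ℕ) + 1 ∈ {k : ℕ | ∃ a ∈ x.partition.part (i, o), k = (a.1 : ℕ) + 1} :=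
    ⟨(i, o), mem_part.2 (Rel.refl _), rfl⟩
  refine le_antisymm (Nat.sInf_le hmem) (le_csInf ⟨_, hmem⟩ ?_)
  rintro _ ⟨a, ha, rfl⟩
  exact Nat.succ_le_succ (le_of_mem_reps hi (Rel.symm (mem_part.1 ha)))

theorem normalized_part {i : Fin n} (hi : i ∈ x.reps) :
    Normalized (x.partition.part (i, false)) :=
  ⟨i, (rep_part hi false).symm, mem_part.2 (Rel.refl _)⟩

theorem exists_part_eq_of_normalized {R : Finset (BarredSet n)} (h : x.IsUnsignedBlock R)
    (h' : Normalized R) : ∃ i ∈ x.reps, R = x.partition.part (i, false) := by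
  obtain ⟨a, rfl⟩ := exists_part_eq h.1
  obtain ⟨⟨j, o⟩, hj, hrel⟩ := exists_rep (isUnsignedBlock_part.1 h)
  obtain ⟨i, hi, hmem⟩ := h'
  rw [show x.partition.part a = _ from hrel, rep_part hj o] at hi
  obtain rfl : i = j := Fin.ext (Nat.succ_injective hi)
  exact ⟨i, hj, Eq.symm (mem_part.1 hmem)⟩

theorem part_ne_part {i j : Fin n} (hi : i ∈ x.reps) (hj : j ∈ x.reps) (h : i ≠ j) :
    x.partition.part (i, false) ≠ x.partition.part (j, false) := fun h' =>
  h (congrArg Prod.fst (rep_unique (b := (i, false)) (c := (j, false)) hi hj h'))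

theorem move_eq_inr_iff {q p : Fin n} {o : Bool} (h : p ≠ q) {v : S ⊕ BarredSet n} :
    move q (.inr (p, o)) v = .inr (p, o) ↔ v = .inr (q, false) ∨ v = .inr (p, o) := by
  rcases v with σ | ⟨i, o'⟩
  · simp [move]
  · by_cases hi : i = q
    · subst hi
      cases o' <;> simp [move, h.symm]
    · simp [move, hi]

theorem part_union_part {q p : Fin n} {o : Bool} (hq : q ∈ x.reps) (hp : p ∈ x.reps)
    (h : p < q) : x.partition.part (q, false) ∪ x.partition.part (p, o) =
      (x.merge q (.inr (p, o))).partition.part (p, o) := by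
  ext b
  rw [Finset.mem_union, mem_part, mem_part, mem_part, rel_merge, code_of_mem_reps hp,
    move_of_ne h.ne, move_eq_inr_iff h.ne, ← code_of_mem_reps hp o, ← code_of_mem_reps hq false,
    code_eq_code_iff, code_eq_code_iff]

theorem rel_of_union_mem_parts {y : LabeledPartition n S} {a b : BarredSet n}
    (h : x.partition.part a ∪ x.partition.part b ∈ y.partition.parts) : y.Rel a b :=
  (y.partition.part_eq_of_mem h (Finset.mem_union_left _ (mem_part.2 (Rel.refl a)))).trans
    (y.partition.part_eq_of_mem h (Finset.mem_union_right _ (mem_part.2 (Rel.refl b)))).symm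

theorem coherentMerge_merge {q p : Fin n} (hq : q ∈ x.reps) (hp : p ∈ x.reps) (h : p < q) :
    CoherentMerge x (x.merge q (.inr (p, false))) (x.partition.part (q, false))
      (x.partition.part (p, false)) :=
  ⟨isUnsignedBlock_part.2 (sgn_eq_none_of_mem_reps hq _),
    isUnsignedBlock_part.2 (sgn_eq_none_of_mem_reps hp _), normalized_part hq, normalized_part hp,
    part_ne_part hq hp h.ne', by rw [part_union_part hq hp h]; exact part_mem_parts _ _⟩

theorem nonCoherentMerge_merge {q p : Fin n} (hq : q ∈ x.reps) (hp : p ∈ x.reps) (h : p < q) :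
    NonCoherentMerge x (x.merge q (.inr (p, true))) (x.partition.part (q, false))
      (x.partition.part (p, false)) :=
  ⟨isUnsignedBlock_part.2 (sgn_eq_none_of_mem_reps hq _),
    isUnsignedBlock_part.2 (sgn_eq_none_of_mem_reps hp _), normalized_part hq, normalized_part hp,
    part_ne_part hq hp h.ne', by
      rw [← part_flip, flip_mk, Bool.not_false, part_union_part hq hp h]
      exact part_mem_parts _ _⟩

/-- Needed because `label` tests for coherent merges before noncoherent ones. -/
theorem not_coherentMerge_merge {q p : Fin n} {R R' : Finset (BarredSet n)} :
    ¬CoherentMerge x (x.merge q (.inr (p, true))) R R' := by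
  rintro ⟨hR, hR', hn, hn', hne, hmem⟩
  obtain ⟨i, hi, rfl⟩ := exists_part_eq_of_normalized hR hn
  obtain ⟨j, hj, rfl⟩ := exists_part_eq_of_normalized hR' hn'
  have hij : i ≠ j := fun h => hne (by rw [h])
  have hrel := rel_of_union_mem_parts hmem
  rw [rel_merge, code_of_mem_reps hi, code_of_mem_reps hj] at hrel
  by_cases hiq : i = q <;> by_cases hjq : j = q <;> simp_all [move]

/-- The pair used in `label` comes from `choose`, so the value must be computed for every admissible
pair; these are the blocks of `q` and `p` in either order. -/
theorem min_rep_of_nonCoherentMerge {q p : Fin n} (h : p < q) {R R' : Finset (BarredSet n)}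
    (hRR' : NonCoherentMerge x (x.merge q (.inr (p, true))) R R') :
    min (rep R) (rep R') = (p : ℕ) + 1 := by
  obtain ⟨hR, hR', hn, hn', hne, hmem⟩ := hRR'
  obtain ⟨i, hi, rfl⟩ := exists_part_eq_of_normalized hR hn
  obtain ⟨j, hj, rfl⟩ := exists_part_eq_of_normalized hR' hn'
  have hij : i ≠ j := fun h => hne (by rw [h])
  rw [← part_flip, flip_mk, Bool.not_false] at hmem
  have hrel := rel_of_union_mem_parts hmem
  rw [rel_merge, code_of_mem_reps hi, code_of_mem_reps hj] at hrel
  rw [rep_part hi, rep_part hj]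
  have hpq : (p : ℕ) < q := h
  by_cases hiq : i = q
  · subst hiq
    rw [move_self, move_of_ne (by exact hij.symm)] at hrel
    obtain rfl : p = j := congrArg Prod.fst (Sum.inr_injective hrel)
    omega
  · rw [move_of_ne (by exact hiq)] at hrel
    by_cases hjq : j = q
    · subst hjq
      rw [move_self_true, sumFlip_inr] at hrel
      obtain rfl : i = p := congrArg Prod.fst (Sum.inr_injective hrel)
      omega
    · rw [move_of_ne (by exact hjq)] at hrel
      exact absurd (congrArg Prod.snd (Sum.inr_injective hrel)) (by simp)

theorem not_isOfSign_merge_inr {q : Fin n} (hq : q ∈ x.reps) (b : BarredSet n) :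
    ¬∃ σ, IsOfSign x (x.merge q (.inr b)) σ := by
  simp [isOfSign_merge_iff hq]

/-- The second entry can stay unknown: no decreasing chain to `1̂` contains a label with first entry
`0`. -/
theorem label_merge_false [LinearOrder S] {q p : Fin n} (hq : q ∈ x.reps) (hp : p ∈ x.reps)
    (h : p < q) : ∃ k, label x (x.merge q (.inr (p, false))) = toLex (0, k) := by
  rw [label, dif_neg (not_isOfSign_merge_inr hq _),
    dif_pos ⟨(_, _), coherentMerge_merge hq hp h⟩]
  exact ⟨_, rfl⟩

theorem label_merge_true [LinearOrder S] {q p : Fin n} (hq : q ∈ x.reps) (hp : p ∈ x.reps)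
    (h : p < q) : label x (x.merge q (.inr (p, true))) = toLex (2, (p : ℕ) + 1) := by
  have hex : ∃ P : Finset (BarredSet n) × Finset (BarredSet n),
    NonCoherentMerge x (x.merge q (.inr (p, true))) P.1 P.2 :=
    ⟨(_, _), nonCoherentMerge_merge hq hp h⟩
  rw [label, dif_neg (not_isOfSign_merge_inr hq _),
    dif_neg (fun ⟨_, h'⟩ => not_coherentMerge_merge h'), dif_pos hex,
    min_rep_of_nonCoherentMerge h hex.choose_spec]

/-! ### The labels of the signed edges -/

section SignIndex

variable [LinearOrder S]

open Classical in
/-- The set of signs counted by the label of an edge of sign `σ`. -/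
noncomputable def signSet (A : Set S) (σ : S) : Set S :=
  if σ ∈ A then {τ | τ ∈ A ∧ τ ≤ σ} else {τ | τ ≤ σ} ∪ A

theorem signedLabel_eq (x : LabeledPartition n S) (σ : S) :
    signedLabel x σ = toLex (1, (signSet x.signs σ).ncard) := by
  unfold signedLabel signSet
  split_ifs <;> rfl

theorem mem_signSet_self (A : Set S) (σ : S) : σ ∈ signSet A σ := by
  unfold signSet
  split_ifs with h
  · exact ⟨h, le_rfl⟩
  · exact Or.inl (le_refl σ)

/-- The sets form a strict chain: for signs in `A` they are initial segments of `A`, and for signs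
outside `A` they strictly contain `A` and grow with the sign. -/
theorem signSet_ssubset (A : Set S) {σ τ : S} (h : σ < τ) :
    signSet A σ ⊂ signSet A τ ∨ signSet A τ ⊂ signSet A σ := by
  have key : ∀ {σ τ : S}, σ ∈ A → τ ∉ A → signSet A σ ⊂ signSet A τ := by
    intro σ τ hσ hτ
    rw [Set.ssubset_iff_of_subset]
    · exact ⟨τ, mem_signSet_self A τ, by simp [signSet, hσ, hτ]⟩
    · intro ρ hρ
      simp only [signSet, hσ, hτ, if_true, if_false] at hρ ⊢
      exact Or.inr hρ.1
  by_cases hσ : σ ∈ A <;> by_cases hτ : τ ∈ A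
  · left
    rw [Set.ssubset_iff_of_subset]
    · exact ⟨τ, mem_signSet_self A τ, by simp [signSet, hσ, hτ, h]⟩
    · intro ρ hρ
      simp only [signSet, hσ, hτ, if_true] at hρ ⊢
      exact ⟨hρ.1, hρ.2.trans h.le⟩
  · exact Or.inl (key hσ hτ)
  · exact Or.inr (key hτ hσ)
  · left
    rw [Set.ssubset_iff_of_subset]
    · exact ⟨τ, mem_signSet_self A τ, by simp [signSet, hσ, hτ, h]⟩
    · intro ρ hρ
      simp only [signSet, hσ, hτ, if_false] at hρ ⊢
      exact hρ.imp (fun h' => le_trans h' h.le) id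

/-- The cardinalities are distinct and lie between `1` and `|S|`, so each value occurs exactly once,
whatever `A` is. -/
theorem sum_signSet [Fintype S] (A : Set S) (F : ℕ → ℕ) :
    ∑ σ, F (signSet A σ).ncard = ∑ j ∈ Finset.Icc 1 (Nat.card S), F j := by
  have hinj : Function.Injective fun σ => (signSet A σ).ncard := by
    have hlt : ∀ {σ τ}, σ < τ → (signSet A σ).ncard ≠ (signSet A τ).ncard := by
      intro σ τ h
      rcases signSet_ssubset A h with h | h
      · exact (Set.ncard_lt_ncard h (Set.toFinite _)).ne
      · exact (Set.ncard_lt_ncard h (Set.toFinite _)).ne'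
    intro σ τ h
    rcases lt_trichotomy σ τ with h' | h' | h'
    · exact absurd h (hlt h')
    · exact h'
    · exact absurd h.symm (hlt h')
  have himage : Finset.univ.image (fun σ => (signSet A σ).ncard) =
      Finset.Icc 1 (Nat.card S) := by
    refine Finset.eq_of_subset_of_card_le ?_ ?_
    · intro j hj
      obtain ⟨σ, -, rfl⟩ := Finset.mem_image.1 hj
      refine Finset.mem_Icc.2 ⟨?_, ?_⟩
      · exact (Set.ncard_pos (Set.toFinite _)).2 ⟨σ, mem_signSet_self A σ⟩
      · rw [← Set.ncard_univ]
        exact Set.ncard_le_ncard (Set.subset_univ _) (Set.toFinite _)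
    · rw [Finset.card_image_of_injective _ hinj]
      simp
  rw [← himage, Finset.sum_image fun _ _ _ _ h => hinj h]

end SignIndex

end LabeledPartition

/-! ## Counting decreasing chains -/

section Chains

variable {P L : Type*} [PartialOrder P] [LinearOrder L] (lam : P → P → L)

/-- The maximal chains from `x` to `y` with decreasing words whose labels are at most `l`. -/
def decChains (x y : P) (l : L) : Set (List P) :=
  {c | IsMaximalChainBetween x y c ∧ IsDecreasingChain lam c ∧ ∀ w ∈ chainWord lam c, w ≤ l}

variable {lam}

/-- The bound `l` makes the condition recursive: after the first edge, its label becomes the bound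
for the rest. -/
theorem cons_cons_mem_decChains {x y z : P} {l : L} {c : List P} :
    x :: z :: c ∈ decChains lam x y l ↔
      x ⋖ z ∧ lam x z ≤ l ∧ z :: c ∈ decChains lam z y (lam x z) := by
  have hw : chainWord lam (x :: z :: c) = lam x z :: chainWord lam (z :: c) := rfl
  simp only [decChains, Set.mem_ofPred_eq, IsMaximalChainBetween, IsDecreasingChain, hw,
    List.pairwise_cons, List.isChain_cons_cons, List.mem_cons, List.head?_cons,
    List.getLast?_cons_cons, forall_eq_or_imp, true_and, ge_iff_le]
  constructor
  · rintro ⟨⟨h1, h2, h3⟩, ⟨h4, h5⟩, h6, -⟩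
    exact ⟨h2, h6, ⟨h1, h3⟩, h5, h4⟩
  · rintro ⟨h2, h6, ⟨h1, h3⟩, h5, h4⟩
    exact ⟨⟨h1, h2, h3⟩, ⟨h4, h5⟩, h6, fun w hw => (h4 w hw).trans h6⟩

theorem exists_eq_cons_cons {x y : P} {l : L} {c : List P} (hxy : x ≠ y)
    (hc : c ∈ decChains lam x y l) : ∃ z c', c = x :: z :: c' := by
  obtain ⟨h1, h2, -⟩ := hc.1
  match c, h1, h2 with
  | [a], h1, h2 =>
    simp only [List.head?_cons, Option.some.injEq, List.getLast?_singleton] at h1 h2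
    exact absurd (h1.symm.trans h2) hxy
  | a :: z :: c', h1, _ =>
    simp only [List.head?_cons, Option.some.injEq] at h1
    exact ⟨z, c', by rw [h1]⟩

theorem head_of_mem_decChains {x y : P} {l : L} {c : List P} (hc : c ∈ decChains lam x y l) :
    ∃ c', c = x :: c' := by
  obtain ⟨h1, -, -⟩ := hc.1
  match c, h1 with
  | a :: c', h1 =>
    simp only [List.head?_cons, Option.some.injEq] at h1
    exact ⟨c', by rw [h1]⟩

theorem decChains_finite [Finite P] (x y : P) (l : L) : (decChains lam x y l).Finite := by
  classical
  have := Fintype.ofFinite P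
  have hfin : {c : List P | c.Nodup}.Finite :=
    Set.finite_coe_iff.1 (inferInstanceAs (Finite {c : List P // c.Nodup}))
  refine hfin.subset fun c hc => ?_
  have h : c.IsChain (· < ·) := hc.1.2.2.imp fun _ _ h => h.lt
  exact (List.isChain_iff_pairwise.1 h).imp fun h => h.ne

theorem ncard_decChains_top {x : P} (hx : IsMax x) (l : L) :
    (decChains lam x x l).ncard = 1 := by
  rw [Set.ncard_eq_one]
  refine ⟨[x], Set.eq_singleton_iff_unique_mem.2 ⟨?_, fun c hc => ?_⟩⟩
  · simp [decChains, IsMaximalChainBetween, IsDecreasingChain, chainWord]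
  · obtain ⟨c', rfl⟩ := head_of_mem_decChains hc
    cases c' with
    | nil => rfl
    | cons z c' => exact absurd (cons_cons_mem_decChains.1 hc).1.lt hx.not_lt

/-- Chains are sorted by their second element, which `e` parametrizes bijectively by `s`. -/
theorem ncard_decChains [Finite P] {ι : Type*} {x y : P} (hxy : x ≠ y) (s : Finset ι) (e : ι → P)
    (he : Set.InjOn e s) (hs : ∀ z, x ⋖ z ↔ ∃ i ∈ s, e i = z) (l : L) :
    (decChains lam x y l).ncard = ∑ i ∈ s, if lam x (e i) ≤ l then
      (decChains lam (e i) y (lam x (e i))).ncard else 0 := by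
  classical
  let F : ι → Finset (List P) := fun i => if lam x (e i) ≤ l then
    (decChains_finite (lam := lam) (e i) y (lam x (e i))).toFinset.image (x :: ·) else ∅
  have hF : ∀ i c, c ∈ F i ↔ lam x (e i) ≤ l ∧
      ∃ c' ∈ decChains lam (e i) y (lam x (e i)), x :: c' = c := by
    intro i c
    by_cases h : lam x (e i) ≤ l <;> simp [F, h]
  have hunion : decChains lam x y l = (s.biUnion F : Finset (List P)) := by
    ext c
    simp only [Finset.coe_biUnion, Set.mem_iUnion, Finset.mem_coe, hF, exists_prop]
    constructor
    · intro hc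
      obtain ⟨z, c', rfl⟩ := exists_eq_cons_cons hxy hc
      obtain ⟨h1, h2, h3⟩ := cons_cons_mem_decChains.1 hc
      obtain ⟨i, hi, rfl⟩ := (hs z).1 h1
      exact ⟨i, hi, h2, _, h3, rfl⟩
    · rintro ⟨i, hi, h2, c', h3, rfl⟩
      obtain ⟨c'', rfl⟩ := head_of_mem_decChains h3
      exact cons_cons_mem_decChains.2 ⟨(hs _).2 ⟨i, hi, rfl⟩, h2, h3⟩
  rw [hunion, Set.ncard_coe_finset, Finset.card_biUnion]
  · refine Finset.sum_congr rfl fun i _ => ?_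
    by_cases h : lam x (e i) ≤ l
    · simp only [F, h, if_true]
      rw [Finset.card_image_of_injective _ List.cons_injective,
        ← Set.ncard_eq_toFinset_card _ (decChains_finite _ _ _)]
    · simp [F, h]
  · intro i hi j hj hij
    rw [Function.onFun, Finset.disjoint_left]
    intro c hc hc'
    obtain ⟨-, c1, h1, rfl⟩ := (hF i c).1 hc
    obtain ⟨-, c2, h2, h⟩ := (hF j _).1 hc'
    obtain rfl := List.cons_injective h
    obtain ⟨d1, rfl⟩ := head_of_mem_decChains h1
    obtain ⟨d2, hd⟩ := head_of_mem_decChains h2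
    exact hij (he hi hj (List.cons.inj hd).1)

end Chains

/-! ### The recursion for decreasing chains to the top -/

namespace LabeledPartition

variable {n : ℕ} {S : Type*}

instance [Finite S] : Finite (LabeledPartition n S) :=
  Finite.of_injective (fun x => (x.partition, x.sign)) fun _ _ h =>
    LabeledPartition.ext (congrArg Prod.fst h) (congrArg Prod.snd h)

instance [Finite S] : Finite (LabeledPartitionPoset n S) :=
  inferInstanceAs (Finite (Option (LabeledPartition n S)))

/-- Since `reps` is antitone, one labeled partition above `⊥` in which every index is a
representative is enough. -/
theorem reps_bot : (⊥ : LabeledPartition n S).reps = Finset.univ := by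
  let x : LabeledPartition n S := ofFun (fun a => .inr a) fun a => rfl
  have hx : x.reps = Finset.univ := by
    refine Finset.eq_univ_of_forall fun i => mem_reps_of (o := false) ?_ fun b hb => ?_
    · cases h : x.sgn (i, false) with
      | none => rfl
      | some σ => exact absurd ((sgn_ofFun _ _).1 h) (by simp)
    · rw [← Sum.inr_injective ((rel_ofFun _ _).1 hb)]
  exact Finset.eq_univ_of_forall fun i => reps_anti (bot_le (a := x)) (hx ▸ Finset.mem_univ i)

variable {x : LabeledPartition n S}

theorem isMax_of_reps_eq_empty (h : x.reps = ∅) : IsMax x := by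
  intro y hy
  rw [eq_of_le_of_reps_subset hy (by simp [h])]

theorem coe_covBy_top_iff [Nonempty S] :
    (WithTop.some x : LabeledPartitionPoset n S) ⋖ ⊤ ↔ x.reps = ∅ := by
  constructor
  · intro h
    by_contra hne
    obtain ⟨q, hq⟩ := Finset.nonempty_iff_ne_empty.2 hne
    obtain ⟨σ⟩ := ‹Nonempty S›
    -- An unsigned block that is left can still be given a sign, so something lies strictly below
    -- `1̂`.
    have hlt := (covBy_merge hq (t := .inl σ) fun b hb => by simp at hb).lt
    exact h.2 (WithTop.coe_lt_coe.2 hlt) (WithTop.coe_lt_top _)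
  · intro h
    refine ⟨WithTop.coe_lt_top x, fun z hz hz' => ?_⟩
    obtain ⟨y, rfl⟩ := WithTop.ne_top_iff_exists.1 hz'.ne
    exact (isMax_of_reps_eq_empty h).not_lt (WithTop.coe_lt_coe.1 hz)

open Classical in
/-- The choices of `q` and `t` for which `x.merge q t` covers `x`. -/
noncomputable def mergeIndices [Fintype S] (x : LabeledPartition n S) :
    Finset (Fin n × (S ⊕ BarredSet n)) :=
  Finset.univ.filter fun i => i.1 ∈ x.reps ∧ x.IsTarget i.1 i.2

theorem mem_mergeIndices [Fintype S] {i : Fin n × (S ⊕ BarredSet n)} :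
    i ∈ x.mergeIndices ↔ i.1 ∈ x.reps ∧ x.IsTarget i.1 i.2 := by
  simp [mergeIndices]

theorem sum_mergeIndices [Fintype S] (F : Fin n → S ⊕ BarredSet n → ℕ) :
    ∑ i ∈ x.mergeIndices, F i.1 i.2 = ∑ q ∈ x.reps, ∑ σ, F q (.inl σ) +
      ∑ q ∈ x.reps, ∑ p ∈ x.reps.filter (· < q), (F q (.inr (p, false)) + F q (.inr (p, true))) := by
  classical
  rw [mergeIndices, Finset.sum_filter, Fintype.sum_prod_type, ← Finset.sum_add_distrib,
    ← Finset.sum_filter_add_sum_filter_not Finset.univ (· ∈ x.reps)]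
  rw [Finset.sum_eq_zero (s := Finset.univ.filter (· ∉ x.reps)), add_zero]
  · have : Finset.univ.filter (· ∈ x.reps) = x.reps := by ext; simp
    rw [this]
    refine Finset.sum_congr rfl fun q hq => ?_
    rw [Fintype.sum_sum_type, Fintype.sum_prod_type]
    congr 1
    · exact Finset.sum_congr rfl fun σ _ => if_pos ⟨hq, fun b hb => by simp at hb⟩
    · have h : ∀ b, (q ∈ x.reps ∧ x.IsTarget q (.inr b)) ↔ b.1 ∈ x.reps ∧ b.1 < q := fun b =>
        ⟨fun h => h.2 b rfl, fun h => ⟨hq, fun c hc => Sum.inr_injective hc ▸ h⟩⟩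
      simp only [h, Fintype.sum_bool]
      rw [← Finset.sum_filter_add_sum_filter_not Finset.univ (fun p => p ∈ x.reps ∧ p < q)]
      rw [Finset.sum_eq_zero (s := Finset.univ.filter fun p => ¬(p ∈ x.reps ∧ p < q)), add_zero]
      · refine Finset.sum_congr ?_ fun p hp => ?_
        · ext p
          simp
        · rw [if_pos (Finset.mem_filter.1 hp), if_pos (Finset.mem_filter.1 hp), add_comm]
      · intro p hp
        have hp := (Finset.mem_filter.1 hp).2
        rw [if_neg hp, if_neg hp, add_zero]
  · intro q hq
    refine Finset.sum_eq_zero fun t _ => if_neg fun h => ?_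
    exact (Finset.mem_filter.1 hq).2 h.1

variable [LinearOrder S]

/-- The number of decreasing maximal chains from `x` to `1̂` with labels at most `l`. -/
noncomputable def chainCount (x : LabeledPartition n S) (l : ℕ ×ₗ ℕ) : ℕ :=
  (decChains edgeLabel (WithTop.some x : LabeledPartitionPoset n S) ⊤ l).ncard

theorem edgeLabel_coe (x y : LabeledPartition n S) :
    edgeLabel (WithTop.some x : LabeledPartitionPoset n S) (WithTop.some y) = label x y := rfl

theorem edgeLabel_top (x : LabeledPartition n S) :
    edgeLabel (WithTop.some x : LabeledPartitionPoset n S) ⊤ = toLex (1, 2) := rfl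

theorem chainCount_of_reps_eq_empty [Finite S] [Nonempty S] (h : x.reps = ∅) (l : ℕ ×ₗ ℕ) :
    x.chainCount l = if toLex (1, 2) ≤ l then 1 else 0 := by
  rw [chainCount, ncard_decChains (WithTop.coe_ne_top) {()} (fun _ => ⊤) (by simp)]
  · rw [Finset.sum_singleton, edgeLabel_top, ncard_decChains_top isMax_top]
  · intro z
    rw [show (∃ i ∈ ({()} : Finset Unit), ⊤ = z) ↔ ⊤ = z by simp]
    constructor
    · intro hz
      by_contra hne
      obtain ⟨y, rfl⟩ := WithTop.ne_top_iff_exists.1 (Ne.symm hne)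
      exact (isMax_of_reps_eq_empty h).not_lt (WithTop.coe_lt_coe.1 hz.lt)
    · rintro rfl
      exact coe_covBy_top_iff.2 h

theorem chainCount_eq_sum [Fintype S] [Nonempty S] (h : x.reps ≠ ∅) (l : ℕ ×ₗ ℕ) :
    x.chainCount l = ∑ i ∈ x.mergeIndices, if label x (x.merge i.1 i.2) ≤ l then
      (x.merge i.1 i.2).chainCount (label x (x.merge i.1 i.2)) else 0 := by
  rw [chainCount, ncard_decChains (WithTop.coe_ne_top) x.mergeIndices
    (fun i => WithTop.some (x.merge i.1 i.2))]
  · rfl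
  · rintro ⟨q, t⟩ h1 ⟨q', t'⟩ h2 h
    simp only [mergeIndices, Finset.coe_filter, Finset.mem_univ, true_and, Set.mem_ofPred_eq]
      at h1 h2
    obtain ⟨rfl, rfl⟩ := merge_injective h1.1 h1.2 h2.1 h2.2 (WithTop.coe_injective h)
    rfl
  · intro z
    cases z using WithTop.recTopCoe with
    | top =>
      rw [coe_covBy_top_iff]
      simp [h]
    | coe y =>
      rw [WithTop.coe_covBy_coe, covBy_iff]
      simp only [mergeIndices, Finset.mem_filter, Finset.mem_univ, true_and, Prod.exists,
        WithTop.coe_inj]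
      constructor
      · rintro ⟨q, hq, t, ht, h⟩
        exact ⟨q, t, ⟨hq, ht⟩, h⟩
      · rintro ⟨q, t, ⟨hq, ht⟩, h⟩
        exact ⟨q, hq, t, ht, h⟩

/-- The last edge of every chain has label `(1, 2)`, which exceeds the bound. -/
theorem chainCount_eq_zero [Finite S] [Nonempty S] (x : LabeledPartition n S) {l : ℕ ×ₗ ℕ}
    (hl : l < toLex (1, 2)) : x.chainCount l = 0 := by
  have := Fintype.ofFinite S
  induction hk : x.reps.card using Nat.strong_induction_on generalizing x l with
  | _ k ih =>
    by_cases h : x.reps = ∅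
    · rw [chainCount_of_reps_eq_empty h, if_neg (not_le.2 hl)]
    · rw [chainCount_eq_sum h]
      refine Finset.sum_eq_zero fun i hi => ?_
      split_ifs with hle
      · obtain ⟨h1, h2⟩ := mem_mergeIndices.1 hi
        exact ih _ (hk ▸ card_reps_lt (covBy_merge h1 h2).lt) _ (hle.trans_lt hl) rfl
      · rfl

theorem chainCount_recursion [Fintype S] [Nonempty S] (h : x.reps ≠ ∅) (l : ℕ ×ₗ ℕ) :
    x.chainCount l =
      ∑ q ∈ x.reps, ∑ σ, (if signedLabel x σ ≤ l then
        (x.merge q (.inl σ)).chainCount (signedLabel x σ) else 0) +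
      ∑ q ∈ x.reps, ∑ p ∈ x.reps.filter (· < q), (if toLex (2, (p : ℕ) + 1) ≤ l then
        (x.merge q (.inr (p, true))).chainCount (toLex (2, (p : ℕ) + 1)) else 0) := by
  rw [chainCount_eq_sum h, sum_mergeIndices (fun q t => if label x (x.merge q t) ≤ l then
      (x.merge q t).chainCount (label x (x.merge q t)) else 0)]
  congr 1
  · refine Finset.sum_congr rfl fun q hq => Finset.sum_congr rfl fun σ _ => ?_
    rw [label_merge_inl hq]
  · refine Finset.sum_congr rfl fun q hq => Finset.sum_congr rfl fun p hp => ?_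
    obtain ⟨hp, hpq⟩ := Finset.mem_filter.1 hp
    obtain ⟨k, hk⟩ := label_merge_false hq hp hpq
    rw [label_merge_true hq hp hpq, hk, chainCount_eq_zero _
      (Prod.Lex.toLex_lt_toLex.2 (Or.inl (by norm_num))), ite_self, zero_add]

end LabeledPartition

/-! ## The number of decreasing chains in the elliptic poset -/

/-- The ranks of the elements of `T` run once through `1, …, |T|`. -/
theorem Finset.sum_card_filter_le {α M : Type*} [LinearOrder α] [AddCommMonoid M] (T : Finset α)
    (F : ℕ → M) : ∑ p ∈ T, F (T.filter (· ≤ p)).card = ∑ r ∈ Finset.Icc 1 T.card, F r := by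
  induction T using Finset.induction_on_max with
  | empty => simp
  | insert a s ha ih =>
    have hns : a ∉ s := fun h => lt_irrefl a (ha a h)
    rw [Finset.sum_insert hns, Finset.card_insert_of_notMem hns, Finset.sum_Icc_succ_top (by omega),
      ← ih, add_comm]
    congr 1
    · refine Finset.sum_congr rfl fun p hp => ?_
      rw [Finset.filter_insert, if_neg (not_le.2 (ha p hp))]
    · rw [Finset.filter_true_of_mem, Finset.card_insert_of_notMem hns]
      intro p hp
      rcases Finset.mem_insert.1 hp with rfl | hp
      · exact le_rfl
      · exact (ha p hp).le

namespace LabeledPartition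

variable {n : ℕ} {S : Type*} [LinearOrder S] {x : LabeledPartition n S}

/-- The number of decreasing chains from a labeled partition with `k` pairs of unsigned blocks to
`1̂` with labels at most `(1, j)`, if there are four signs. -/
def signedChainCount (k : ℕ) : ℕ → ℕ
  | 2 => k !
  | 3 => (k + 1)!
  | 4 => (k + 2)! / 2
  | _ => 0

theorem two_mul_signedChainCount (k : ℕ) : 2 * signedChainCount k 4 = (k + 2)! :=
  Nat.mul_div_cancel' (Nat.dvd_factorial (by norm_num) (by omega))

theorem Icc_one_four : Finset.Icc 1 4 = ({1, 2, 3, 4} : Finset ℕ) := by decide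

theorem toLex_one_le {i j : ℕ} : toLex (1, i) ≤ toLex (1, j) ↔ i ≤ j := by
  simp [Prod.Lex.toLex_le_toLex]

/-- For each of the `k + 1` representatives the four signs realize each index once, and the result
always has `k` representatives. -/
theorem sum_signedLabel [Fintype S] (hS : Nat.card S = 4) {k : ℕ} (hk : x.reps.card = k + 1)
    (ih : ∀ y : LabeledPartition n S, y.reps.card = k → ∀ j ∈ Finset.Icc 1 4,
      y.chainCount (toLex (1, j)) = signedChainCount k j) (l : ℕ ×ₗ ℕ) :
    ∑ q ∈ x.reps, ∑ σ, (if signedLabel x σ ≤ l then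
        (x.merge q (.inl σ)).chainCount (signedLabel x σ) else 0) =
      (k + 1) * ∑ j ∈ Finset.Icc 1 4, if toLex (1, j) ≤ l then signedChainCount k j else 0 := by
  have h : ∀ q ∈ x.reps, ∑ σ, (if signedLabel x σ ≤ l then
      (x.merge q (.inl σ)).chainCount (signedLabel x σ) else 0) =
      ∑ j ∈ Finset.Icc 1 4, if toLex (1, j) ≤ l then signedChainCount k j else 0 := by
    intro q hq
    rw [← hS, ← sum_signSet x.signs
      (fun j => if toLex (1, j) ≤ l then signedChainCount k j else 0)]
    refine Finset.sum_congr rfl fun σ _ => ?_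
    rw [signedLabel_eq, ih]
    · rw [reps_merge hq fun b hb => by simp at hb, Finset.card_erase_of_mem hq, hk,
        Nat.add_sub_cancel]
    · rw [Finset.mem_Icc, ← hS, ← Set.ncard_univ]
      exact ⟨(Set.ncard_pos (Set.toFinite _)).2 ⟨σ, mem_signSet_self _ σ⟩,
        Set.ncard_le_ncard (Set.subset_univ _) (Set.toFinite _)⟩
  rw [Finset.sum_congr rfl h, Finset.sum_const, hk, smul_eq_mul]

theorem sum_signedChainCount (k : ℕ) {l : ℕ ×ₗ ℕ} (hl : toLex (1, 4) ≤ l) :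
    (k + 1) * (∑ j ∈ Finset.Icc 1 4, if toLex (1, j) ≤ l then signedChainCount k j else 0) =
      signedChainCount (k + 1) 4 := by
  have h : ∀ j ∈ Finset.Icc 1 4, (if toLex (1, j) ≤ l then signedChainCount k j else 0) =
      signedChainCount k j := fun j hj =>
    if_pos ((toLex_one_le.2 (Finset.mem_Icc.1 hj).2).trans hl)
  rw [Finset.sum_congr rfl h, Icc_one_four]
  have h1 := two_mul_signedChainCount k
  have h2 := two_mul_signedChainCount (k + 1)
  have h3 : (k + 1 + 2)! = (k + 3) * (k + 2)! := Nat.factorial_succ (k + 2)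
  have h4 : (k + 2)! = (k + 2) * (k + 1)! := Nat.factorial_succ (k + 1)
  have h5 : (k + 1)! = (k + 1) * k ! := Nat.factorial_succ k
  have h6 : signedChainCount k 1 = 0 := rfl
  have h7 : signedChainCount k 2 = k ! := rfl
  have h8 : signedChainCount k 3 = (k + 1)! := rfl
  simp only [Finset.mem_insert, Finset.mem_singleton, OfNat.one_ne_ofNat, or_self,
    not_false_eq_true, Finset.sum_insert, Nat.reduceEqDiff, Finset.sum_singleton, h6, h7, h8]
  nlinarith

theorem chainCount_one [Finite S] (hS : Nat.card S = 4) (x : LabeledPartition n S) {j : ℕ}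
    (hj : j ∈ Finset.Icc 1 4) :
    x.chainCount (toLex (1, j)) = signedChainCount x.reps.card j := by
  have := Fintype.ofFinite S
  have : Nonempty S := (Nat.card_pos_iff.1 (hS ▸ by norm_num)).1
  induction hk : x.reps.card generalizing x j with
  | zero =>
    rw [chainCount_of_reps_eq_empty (Finset.card_eq_zero.1 hk)]
    simp only [toLex_one_le]
    rw [Icc_one_four] at hj
    fin_cases hj <;> rfl
  | succ k ih =>
    have hne : x.reps ≠ ∅ := Finset.card_ne_zero.1 (by omega) |>.ne_empty
    rw [chainCount_recursion hne, sum_signedLabel hS hk fun y hy j hj => ih y hj hy]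
    -- Below `(1, j)` no noncoherent merge is allowed, so only the signed edges remain in the
    -- recursion.
    have h2 : ∀ p : ℕ, ¬toLex (2, p + 1) ≤ toLex (1, j) := fun p => by
      simp [Prod.Lex.toLex_le_toLex]
    simp only [h2, if_false, Finset.sum_const_zero, add_zero]
    by_cases hj4 : j = 4
    · subst hj4
      exact sum_signedChainCount k le_rfl
    · simp only [toLex_one_le]
      rw [Icc_one_four] at hj ⊢
      have h5 : (k + 1)! = (k + 1) * k ! := Nat.factorial_succ k
      have h4 : (k + 2)! = (k + 2) * (k + 1)! := Nat.factorial_succ (k + 1)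
      fin_cases hj
      · simp [signedChainCount]
      · simp [signedChainCount, h5]
      · simp only [signedChainCount, Finset.mem_insert, Finset.mem_singleton, OfNat.one_ne_ofNat,
          or_self, not_false_eq_true, Finset.sum_insert, Nat.reduceEqDiff, Finset.sum_singleton,
          Nat.reduceLeDiff, if_true, if_false, ite_self]
        rw [h4]
        nlinarith
      · simp at hj4

/-! ### Chains that begin with noncoherent merges -/

/-- `chainRatio k i` is the number of decreasing chains from a labeled partition with `k` pairs of
unsigned blocks to `1̂` with labels at most `(2, a)`, if `i` of the representatives of these pairs
are at most `a`, and if there are four signs. -/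
def chainRatio (k i : ℕ) : ℚ := (k + i + 2)! / (2 ^ (i + 1) * (i + 1)!)

theorem chainRatio_zero (k : ℕ) : chainRatio k 0 = signedChainCount k 4 := by
  have h : (2 : ℚ) * signedChainCount k 4 = (k + 2)! := mod_cast two_mul_signedChainCount k
  simp only [chainRatio, add_zero, zero_add, pow_one, Nat.factorial_one, Nat.cast_one, mul_one]
  linarith

/-- Raising the threshold past the representative of rank `i + 1` among `k + 1` admits the `k - i`
merges of larger representatives into it. Over `ℚ` the identity holds for all `i`, with no truncated
subtraction. -/
theorem chainRatio_succ (k i : ℕ) :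
    chainRatio (k + 1) (i + 1) = chainRatio (k + 1) i + (k - i) * chainRatio k (i + 1) := by
  have h1 : (k + 1 + (i + 1) + 2)! = (k + i + 4) * (k + i + 3)! :=
    (congrArg Nat.factorial (by omega)).trans (Nat.factorial_succ (k + i + 3))
  have h2 : (i + 1 + 1)! = (i + 2) * (i + 1)! := Nat.factorial_succ (i + 1)
  have h3 : (k + 1 + i + 2)! = (k + i + 3)! := congrArg Nat.factorial (by omega)
  have h4 : (k + (i + 1) + 2)! = (k + i + 3)! := congrArg Nat.factorial (by omega)
  have h5 : ((i + 1)! : ℚ) ≠ 0 := mod_cast (Nat.factorial_pos _).ne'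
  simp only [chainRatio, h1, h2, h3, h4]
  push_cast
  field_simp
  ring

theorem chainRatio_eq_sum (k i : ℕ) : chainRatio (k + 1) i = signedChainCount (k + 1) 4 +
    ∑ r ∈ Finset.Icc 1 i, ((k : ℚ) + 1 - r) * chainRatio k r := by
  induction i with
  | zero => simp [chainRatio_zero]
  | succ i ih =>
    rw [Finset.sum_Icc_succ_top (by omega), ← add_assoc, ← ih, chainRatio_succ]
    push_cast
    ring

theorem chainCount_two [Finite S] (hS : Nat.card S = 4) (x : LabeledPartition n S) (a : ℕ) :
    (x.chainCount (toLex (2, a)) : ℚ) =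
      chainRatio x.reps.card (x.reps.filter fun p : Fin n => (p : ℕ) + 1 ≤ a).card := by
  have := Fintype.ofFinite S
  have : Nonempty S := (Nat.card_pos_iff.1 (hS ▸ by norm_num)).1
  induction hk : x.reps.card generalizing x a with
  | zero =>
    have h := Finset.card_eq_zero.1 hk
    rw [chainCount_of_reps_eq_empty h, if_pos (by simp [Prod.Lex.toLex_le_toLex]), h]
    simp [chainRatio]
  | succ k ih =>
    have hne : x.reps ≠ ∅ := Finset.card_ne_zero.1 (by omega) |>.ne_empty
    rw [chainCount_recursion hne, sum_signedLabel hS hk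
      fun y hy j hj => hy ▸ chainCount_one hS y hj, sum_signedChainCount k
      (by simp [Prod.Lex.toLex_le_toLex]), chainRatio_eq_sum]
    push_cast
    congr 1
    set T := x.reps.filter fun p : Fin n => (p : ℕ) + 1 ≤ a with hT
    rw [← Finset.sum_card_filter_le T (fun r => ((k : ℚ) + 1 - r) * chainRatio k r)]
    have hle : ∀ p : ℕ, toLex (2, p + 1) ≤ toLex (2, a) ↔ p + 1 ≤ a := fun p => by
      simp [Prod.Lex.toLex_le_toLex]
    simp only [hle, Finset.sum_filter]
    -- The label depends only on `p`, so the outer sum is taken over `p`.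
    rw [Finset.sum_comm, hT, Finset.sum_filter]
    refine Finset.sum_congr rfl fun p hp => ?_
    split_ifs with hpa
    · have hrank : (x.reps.filter fun p : Fin n => (p : ℕ) + 1 ≤ a).filter (· ≤ p) =
          x.reps.filter (· ≤ p) := by
        ext i
        simp only [Finset.mem_filter, and_assoc, and_congr_right_iff, and_iff_right_iff_imp]
        intro _ hi
        have : (i : ℕ) ≤ p := hi
        omega
      have hq : ∀ q ∈ x.reps, (if p < q then
          ((x.merge q (.inr (p, true))).chainCount (toLex (2, (p : ℕ) + 1)) : ℚ) else 0) =
          if p < q then chainRatio k (x.reps.filter (· ≤ p)).card else 0 := by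
        intro q hq
        split_ifs with hpq
        · have hreps := reps_merge hq (t := .inr (p, true))
            fun b hb => Sum.inr_injective hb ▸ ⟨hp, hpq⟩
          rw [ih, hreps]
          -- The removed `q` exceeds `p`, so the rank of `p` is the same after the merge.
          · congr 2
            ext i
            simp only [Finset.mem_filter, Finset.mem_erase, Fin.le_def, Nat.add_le_add_iff_right]
            constructor
            · exact fun h => ⟨h.1.2, h.2⟩
            · refine fun h => ⟨⟨?_, h.1⟩, h.2⟩
              rintro rfl
              exact absurd h.2 (not_le.2 hpq)
          · rw [hreps, Finset.card_erase_of_mem hq, hk, Nat.add_sub_cancel]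
        · rfl
      rw [hrank, Finset.sum_congr rfl hq, ← Finset.sum_filter, Finset.sum_const, nsmul_eq_mul]
      congr 1
      -- The number of choices for `q` is `k + 1` minus the rank of `p`.
      have hcard := Finset.card_filter_add_card_filter_not (s := x.reps) (· ≤ p)
      simp only [not_le] at hcard
      rw [hk] at hcard
      have : (((x.reps.filter (· ≤ p)).card + (x.reps.filter (p < ·)).card : ℕ) : ℚ) =
        (k + 1 : ℕ) := congrArg _ hcard
      push_cast at this
      linarith
    · simp

theorem edgeLabel_le [Finite S] {z : LabeledPartitionPoset n S}
    (h : (WithTop.some x : LabeledPartitionPoset n S) ⋖ z) :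
    edgeLabel (WithTop.some x) z ≤ toLex (2, n) := by
  cases z using WithTop.recTopCoe with
  | top =>
    rw [edgeLabel_top]
    simp [Prod.Lex.toLex_le_toLex]
  | coe y =>
    obtain ⟨q, hq, t, ht, rfl⟩ := covBy_iff.1 (WithTop.coe_covBy_coe.1 h)
    rw [edgeLabel_coe]
    rcases t with σ | ⟨p, o⟩
    · rw [label_merge_inl hq, signedLabel_eq]
      simp [Prod.Lex.toLex_le_toLex]
    · obtain ⟨hp, hpq⟩ := ht _ rfl
      cases o with
      | false =>
        obtain ⟨k, hk⟩ := label_merge_false hq hp hpq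
        rw [hk]
        simp [Prod.Lex.toLex_le_toLex]
      | true =>
        rw [label_merge_true hq hp hpq]
        have : (p : ℕ) + 1 ≤ n := p.2
        simp [Prod.Lex.toLex_le_toLex, this]

end LabeledPartition

/-- The bound `(2, n)` excludes nothing: it holds for the first edge, and the later labels are no
larger. -/
theorem setOf_isDecreasingChain_eq {n : ℕ} {S : Type*} [LinearOrder S] [Finite S] :
    {c : List (LabeledPartitionPoset n S) |
      IsMaximalChainBetween ⊥ ⊤ c ∧ IsDecreasingChain edgeLabel c} =
      decChains edgeLabel ⊥ ⊤ (toLex (2, n)) := by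
  ext c
  refine ⟨fun hc => ⟨hc.1, hc.2, ?_⟩, fun hc => ⟨hc.1, hc.2.1⟩⟩
  obtain ⟨⟨h1, h2, h3⟩, h4⟩ := hc
  match c, h1, h3, h4 with
  | [a], _, _, _ => simp [chainWord]
  | a :: z :: c, h1, h3, h4 =>
    have hw : chainWord edgeLabel (a :: z :: c) =
      edgeLabel a z :: chainWord edgeLabel (z :: c) := rfl
    simp only [List.head?_cons, Option.some.injEq] at h1
    subst h1
    have hle := LabeledPartition.edgeLabel_le (x := (⊥ : LabeledPartition n S))
      (List.isChain_cons_cons.1 h3).1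
    rw [IsDecreasingChain, hw, List.pairwise_cons] at h4
    rw [hw]
    intro w hmem
    rcases List.mem_cons.1 hmem with rfl | hmem
    · exact hle
    · exact (h4.1 w hmem).trans hle

/-- Split $(2n+2)!=(2n+1)!!\,(2n+2)!!$ and use $(2n+2)!!=2^{n+1}(n+1)!$. -/
theorem chainRatio_self (n : ℕ) : LabeledPartition.chainRatio n n = (2 * n + 1)‼ := by
  have h1 : (n + n + 2)! = (2 * n + 1)‼ * (2 ^ (n + 1) * (n + 1)!) := by
    rw [← Nat.doubleFactorial_two_mul, show n + n + 2 = (2 * n + 1) + 1 by omega,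
      Nat.factorial_eq_mul_doubleFactorial, mul_comm]
    rfl
  have h2 : ((2 ^ (n + 1) * (n + 1)! : ℕ) : ℚ) ≠ 0 :=
    mod_cast (Nat.mul_pos (by positivity) (Nat.factorial_pos _)).ne'
  rw [LabeledPartition.chainRatio, h1]
  push_cast at h2 ⊢
  field_simp

theorem ncard_decreasing_chains (n : ℕ) {S : Type*} [LinearOrder S] (hS : Nat.card S = 4) :
    Set.ncard {c : List (LabeledPartitionPoset n S) |
      IsMaximalChainBetween ⊥ ⊤ c ∧ IsDecreasingChain edgeLabel c} = (2 * n + 1)‼ := by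
  have : Finite S := Nat.finite_of_card_ne_zero (by omega)
  rw [setOf_isDecreasingChain_eq]
  have h := LabeledPartition.chainCount_two hS (⊥ : LabeledPartition n S) n
  rw [LabeledPartition.reps_bot, Finset.filter_true_of_mem fun p _ => Nat.succ_le_of_lt p.2,
    Finset.card_univ,
    Fintype.card_fin, chainRatio_self] at h
  exact_mod_cast h

theorem mainTheorem6 (n : ℕ) :
    (∀ m : ℕ, 2 ≤ m →
      partitionSum n (typeCWeight m) = Nat.card (BloomingTree (m - 2) n)) ∧
    (∀ (S : Type*) [LinearOrder S], Nat.card S = 4 →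
      Set.ncard {c : List (LabeledPartitionPoset n S) |
        IsMaximalChainBetween ⊥ ⊤ c ∧ IsDecreasingChain edgeLabel c} = (2 * n + 1)‼) :=
  ⟨fun m hm => by rw [partitionSum_typeCWeight n m hm, BloomingTree.card_eq_prod],
    fun _ _ hS => ncard_decreasing_chains n hS⟩
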